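/- Let $d\in\{2,3\}$ and let $D\subset\mathbb R^d$ be a bounded open set with Lipschitz boundary, outward unit normal $\vec n_{\partial D}$ and surface measure $\mathrm do_x$. Let $\alpha,\tau_n,\theta>0$, and let $\vec\Omega$ be a field on $D$ with values in $\mathbb R$ if $d=2$ and in $\mathbb R^3$ if $d=3$; for $d=2$ put $\vec v\times\vec\Omega:=(v_2,-v_1)^{T}\,\Omega$. Let $\rho^n\in C(\overline D)$, $\vec v^{n}\in L^2(D)^d$, $\vec v^{n+\theta}\in C(\overline D)^d$ and $\varphi^n,\varphi^{n+\theta}\in C^1(\overline D)$, and let $(\vec v^{n+1},\varphi^{n+1})$ be obtained from one step of the $\theta$-scheme in $D$: $$\begin{aligned} \vec v^{n+\theta}&=\vec v^n-\theta\tau_n\nabla\varphi^{n+\theta}+\theta\tau_n\,\vec v^{n+\theta}\times\vec\Omega,\\ -\Delta\varphi^{n+\theta}&=-\Delta\varphi^n-\theta\tau_n\alpha\,\nabla\cdot(\rho^n\vec v^{n+\theta}),\\ \vec v^{n+1}&=\tfrac1\theta\vec v^{n+\theta}-\tfrac{1-\theta}{\theta}\vec v^n,\qquad \varphi^{n+1}=\tfrac1\theta\varphi^{n+\theta}-\tfrac{1-\theta}{\theta}\varphi^n,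 \end{aligned}$$ where the second equation holds in the sense of distributions on $D$. Then all of the integrals below exist, and $$\begin{aligned} &\frac1{2\alpha}\int_D\alpha\rho^n|\vec v^{n+1}|^2+|\nabla\varphi^{n+1}|^2\,\mathrm dx +2\Big(\theta-\frac12\Big)\frac1{2\alpha}\int_D\alpha\rho^n|\vec v^{n+1}-\vec v^n|^2+|\nabla\varphi^{n+1}-\nabla\varphi^n|^2\,\mathrm dx\\ &\quad=\frac1{2\alpha}\int_D\alpha\rho^n|\vec v^{n}|^2+|\nabla\varphi^{n}|^2\,\mathrm dx +\tau_n\int_{\partial D}\Big\{\frac1\alpha\,\frac{\nabla\varphi^{n+\theta}-\nabla\varphi^n}{\theta\tau_n}-\rho^n\vec v^{n+\theta}\Big\}\cdot\vec n_{\partial D}\;\varphi^{n+\theta}\,\mathrm do_x . \end{aligned}$$ -/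

import Mathlib

open MeasureTheory Set Filter Topology
open scoped Gradient RealInnerProductSpace NNReal ContDiff

noncomputable section

namespace EulerPoisson

/-- Points, velocities and gradients: `ℝ^d` with the Euclidean norm. -/
abbrev E (d : ℕ) : Type := EuclideanSpace ℝ (Fin d)

/-! ### Geometry of the domain -/

/-- `D` has a Lipschitz boundary: near each boundary point, after a linear isometric change of
coordinates `x ↦ (x', x_d)`, it is the set of points strictly above the graph of a Lipschitz
function of `x'`. -/
def HasLipschitzBoundary {d : ℕ} (D : Set (E d)) : Prop :=
  ∀ p ∈ frontier D,
    ∃ (e : E d ≃ₗᵢ[ℝ] WithLp 2 (E (d - 1) × ℝ)) (γ : E (d - 1) → ℝ) (K : ℝ≥0),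
      LipschitzWith K γ ∧ ∃ U ∈ 𝓝 p, ∀ y ∈ U, y ∈ D ↔ γ (e y).fst < (e y).snd

/-- `ν` is the outward unit normal of `D` at `x`: for every `ε > 0`, close to `x`, the open set `D`
contains the points `y ≠ x` with `⟪ν, y - x⟫ ≤ -ε ‖y - x‖` and none of those with
`⟪ν, y - x⟫ ≥ ε ‖y - x‖`. -/
def IsOutwardUnitNormal {d : ℕ} (D : Set (E d)) (x ν : E d) : Prop :=
  ‖ν‖ = 1 ∧ ∀ ε : ℝ, 0 < ε → ∀ᶠ y in 𝓝[≠] x,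
    (⟪ν, y - x⟫ ≤ -ε * ‖y - x‖ → y ∈ D) ∧ (ε * ‖y - x‖ ≤ ⟪ν, y - x⟫ → y ∉ D)

open Classical in
/-- The outward unit normal field of `D`; it is `0` at the points that have no normal (a set of
surface measure zero on a Lipschitz boundary). -/
def outwardNormal {d : ℕ} (D : Set (E d)) (x : E d) : E d :=
  if h : ∃ ν, IsOutwardUnitNormal D x ν then h.choose else 0

/-- The outward unit normal at a point is unique, so that `outwardNormal` is it. -/
theorem IsOutwardUnitNormal.unique {d : ℕ} {D : Set (E d)} {x ν₁ ν₂ : E d}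
    (h₁ : IsOutwardUnitNormal D x ν₁) (h₂ : IsOutwardUnitNormal D x ν₂) : ν₁ = ν₂ := by
  by_contra hne
  have hw : 0 < ‖ν₂ - ν₁‖ := norm_pos_iff.2 (sub_ne_zero.2 (Ne.symm hne))
  set w := ν₂ - ν₁ with hwdef
  have e1 : ⟪ν₁, w⟫ = -(‖w‖ ^ 2 / 2) := by
    have h := norm_sub_sq_real ν₂ ν₁
    rw [← hwdef, h₁.1, h₂.1, real_inner_comm] at h
    rw [hwdef, inner_sub_right, real_inner_self_eq_norm_sq, h₁.1]
    linarith
  have e2 : ⟪ν₂, w⟫ = ‖w‖ ^ 2 / 2 := by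
    have h := norm_sub_sq_real ν₂ ν₁
    rw [← hwdef, h₁.1, h₂.1] at h
    rw [hwdef, inner_sub_right, real_inner_self_eq_norm_sq, h₂.1]
    linarith
  have hε : 0 < ‖w‖ / 2 := by positivity
  have hev := (h₁.2 _ hε).and (h₂.2 _ hε)
  have ht : Tendsto (fun t : ℝ => x + t • w) (𝓝[>] 0) (𝓝[≠] x) := by
    refine tendsto_nhdsWithin_iff.2 ⟨?_, ?_⟩
    · have : Continuous (fun t : ℝ => x + t • w) := by fun_prop
      have h0 := this.tendsto 0
      simp only [zero_smul, add_zero] at h0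
      exact h0.mono_left nhdsWithin_le_nhds
    · filter_upwards [self_mem_nhdsWithin] with t ht
      have ht' : t ≠ 0 := ne_of_gt ht
      simp [ht', norm_pos_iff.1 hw]
  obtain ⟨t, ⟨hA, hB⟩, ht0⟩ := ((ht.eventually hev).and self_mem_nhdsWithin).exists
  have ht0 : 0 < t := ht0
  simp only [add_sub_cancel_left, inner_smul_right, norm_smul, Real.norm_eq_abs, abs_of_pos ht0,
    e1, e2] at hA hB
  exact hB.2 (by nlinarith) (hA.1 (by nlinarith))

/-- The surface measure on the boundary of a `d`-dimensional domain: the `(d-1)`-dimensional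
Hausdorff measure, normalised to agree with Lebesgue measure on hyperplanes. -/
def surfaceMeasure {d : ℕ} (D : Set (E d)) : Measure (E d) :=
  (Measure.euclideanHausdorffMeasure (d - 1)).restrict (frontier D)

/-- The class `C¹(D̄)`: `φ` is differentiable in `D`, continuous on the closure, and its gradient is
continuous on `D` with a continuous extension to the closure. -/
structure IsC1UpToBoundary {d : ℕ} (D : Set (E d)) (φ : E d → ℝ) : Prop where
  differentiableAt : ∀ x ∈ D, DifferentiableAt ℝ φ x
  continuousOn : ContinuousOn φ (closure D)
  tendsto_gradient : ∀ x ∈ closure D, ∃ g : E d, Tendsto (∇ φ) (𝓝[D] x) (𝓝 g)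

/-- The gradient of `φ` on the closure of `D`: the extension by continuity of `∇ φ` from `D`. -/
def closureGradient {d : ℕ} (D : Set (E d)) (φ : E d → ℝ) : E d → E d :=
  extendFrom D (∇ φ)

/-! ### The scheme -/

/-- The number of components of the magnetic flux density: one in the (transverse magnetic)
two-dimensional case and three in the three-dimensional case. -/
def magDim : ℕ → ℕ
  | 2 => 1
  | _ => 3

/-- The product `v × B`: `(v₂ B, -v₁ B)` for `d = 2` with scalar `B`, the cross product for `d = 3`
(other dimensions are not used). -/
def magCross : (d : ℕ) → E d → E (magDim d) → E d
  | 2, v, B => !₂[v 1 * B (0 : Fin 1), -(v 0 * B (0 : Fin 1))]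
  | 3, v, B => WithLp.toLp 2 (crossProduct (WithLp.ofLp v) (WithLp.ofLp B))
  | _, _, _ => 0

/-- One step of the time-semi-discrete `θ`-scheme with step size `τ`, from `(vn, φn)` through the
intermediate stage `(vθ, φθ)` to `(v1, φ1)`. The equation
`-Δ φθ = -Δ φn - θ τ α ∇ · (ρ vθ)` is understood in the sense of distributions on `D`. -/
structure IsThetaStep {d : ℕ} (D : Set (E d)) (α τ θ : ℝ) (Ω : E d → E (magDim d)) (ρ : E d → ℝ)
    (vn vθ v1 : E d → E d) (φn φθ φ1 : E d → ℝ) : Prop where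
  velocity : ∀ x ∈ D, vθ x = vn x - (θ * τ) • ∇ φθ x + (θ * τ) • magCross d (vθ x) (Ω x)
  potential : ∀ ψ : E d → ℝ, ContDiff ℝ ∞ ψ → HasCompactSupport ψ → tsupport ψ ⊆ D →
    ∫ x in D, ⟪∇ φθ x, ∇ ψ x⟫ =
      (∫ x in D, ⟪∇ φn x, ∇ ψ x⟫) + θ * τ * α * ∫ x in D, ⟪ρ x • vθ x, ∇ ψ x⟫
  velocity_extrapolation : ∀ x ∈ D, v1 x = (1 / θ) • vθ x - ((1 - θ) / θ) • vn x
  potential_extrapolation : ∀ x ∈ D, φ1 x = (1 / θ) * φθ x - ((1 - θ) / θ) * φn x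

/-! ### The terms of the energy balance -/

/-- The integrand `α ρ |v|² + |g|²` of the energy of a velocity `v` and a potential gradient `g`. -/
def energyDensity {d : ℕ} (α : ℝ) (ρ : E d → ℝ) (v g : E d → E d) (x : E d) : ℝ :=
  α * ρ x * ‖v x‖ ^ 2 + ‖g x‖ ^ 2

/-- The energy `1/(2α) ∫_D α ρ |v|² + |g|² dx`. -/
def energy {d : ℕ} (D : Set (E d)) (α : ℝ) (ρ : E d → ℝ) (v g : E d → E d) : ℝ :=
  1 / (2 * α) * ∫ x in D, energyDensity α ρ v g x

/-- The boundary flux density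
`{(1/α) (∇ φθ - ∇ φn) / (θ τ) - ρ vθ} · n φθ`. -/
def boundaryFlux {d : ℕ} (D : Set (E d)) (α τ θ : ℝ) (ρ : E d → ℝ) (vθ : E d → E d)
    (φn φθ : E d → ℝ) (x : E d) : ℝ :=
  ⟪(1 / α) • (1 / (θ * τ)) • (closureGradient D φθ x - closureGradient D φn x) - ρ x • vθ x,
    outwardNormal D x⟫ * φθ x

end EulerPoisson

end

/-! Let `a` be a quantity at time n, `b` its intermediate stage and `c = a + (b - a)/θ` its
extrapolation. Expanding squares gives |c|² + 2(θ - 1/2)|c - a|² = |a|² + (2/θ)⟨b - a, b⟩. This is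
applied to the velocity, with weight αρ, and to the potential gradient. In the velocity equation
tested with `vθ` the magnetic term drops out, since v × Ω is orthogonal to v. The energy balance
then holds pointwise in `D` with source 2ατ⟨F, ∇φθ⟩, where F is `fluxField`, and the potential
equation says exactly that div F = 0 in the sense of distributions.

What remains is Green's formula ∫_D ⟨F, ∇φ⟩ = ∫_∂D ⟨F, n⟩ φ for a field F that is merely continuous
up to the boundary and weakly divergence free: `WeaklyDivFree.integral_inner_gradient`. As F cannot
be differentiated, everything is done through the test function. A partition of unity η localises to
charts in which `D` is the region above a Lipschitz graph. There the product η · χ(height/ε) · φ,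
with χ a smooth cut-off, is Lipschitz with compact support in `D`, and mollification makes it
admissible (`WeaklyDivFree.integral_inner_gradient_lipschitz`). As ε → 0 the derivative of χ leaves
an average of ⟨ηφF, (-∇γ, 1)⟩ over the collar ε < height < 2ε, which converges to an integral over
the base of the graph (`IsEpigraphOn.tendsto_layer`). Rademacher's theorem and the area formula
(`euclideanHausdorffMeasure_graphMap_image`) identify the limit with the surface integral against
the outward normal. -/

noncomputable section

namespace EulerPoisson

/-! ### Area formula for Lipschitz graphs. -/

section AreaFormula

open Measure Module
open scoped ENNReal

/-- The parametrisation `x ↦ (x, γ x)` of the graph of `γ`. -/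
def graphMap {V : Type*} (γ : V → ℝ) (x : V) : WithLp 2 (V × ℝ) := WithLp.toLp 2 (x, γ x)

theorem continuous_graphMap {V : Type*} [NormedAddCommGroup V] {γ : V → ℝ} (hγ : Continuous γ) :
    Continuous (graphMap γ) :=
  (WithLp.prod_continuous_toLp 2 V ℝ).comp (continuous_id.prodMk hγ)

theorem injective_graphMap {V : Type*} (γ : V → ℝ) : Function.Injective (graphMap γ) := fun x y h => by
  simpa [graphMap] using congrArg WithLp.fst h

variable {V : Type*} [NormedAddCommGroup V] [InnerProductSpace ℝ V]

/-- The area element of a graph. -/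
def areaElement (γ : V → ℝ) (x : V) : ℝ := √(1 + ‖fderiv ℝ γ x‖ ^ 2)

theorem areaElement_pos (γ : V → ℝ) (x : V) : 0 < areaElement γ x :=
  Real.sqrt_pos.2 (by positivity)

/-- The parametrisation of the graph of a linear functional, as a linear map. -/
def graphLinear (a : V →L[ℝ] ℝ) : V →ₗ[ℝ] WithLp 2 (V × ℝ) :=
  (WithLp.linearEquiv 2 ℝ (V × ℝ)).symm.toLinearMap ∘ₗ (LinearMap.id.prod a.toLinearMap)

theorem graphLinear_apply (a : V →L[ℝ] ℝ) (x : V) :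
    graphLinear a x = WithLp.toLp 2 (x, a x) := rfl

theorem measurable_areaElement [MeasurableSpace V] [BorelSpace V] (γ : V → ℝ) : Measurable (areaElement γ) :=
  ((measurable_const.add ((measurable_fderiv ℝ γ).norm.pow_const 2))).sqrt

/-- The two graph maps differ only in the last coordinate, and `graphLinear a` does not shrink
distances. The error thus becomes relative to the linear graph, which gives two-sided Lipschitz
comparisons. -/
theorem dist_graphMap_sub_le (γ : V → ℝ) (a : V →L[ℝ] ℝ) {ε : ℝ} {x y : V}
    (h : ‖γ x - γ y - a (x - y)‖ ≤ ε * ‖x - y‖) :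
    ‖(graphMap γ x - graphMap γ y) - (graphLinear a x - graphLinear a y)‖
      ≤ ε * ‖graphLinear a x - graphLinear a y‖ := by
  have e1 : (graphMap γ x - graphMap γ y) - (graphLinear a x - graphLinear a y)
      = WithLp.toLp 2 ((0 : V), γ x - γ y - a (x - y)) := by
    rw [graphMap, graphMap, graphLinear_apply, graphLinear_apply, ← WithLp.toLp_sub,
      ← WithLp.toLp_sub, ← WithLp.toLp_sub]
    simp [map_sub]
  have e2 : ‖x - y‖ ≤ ‖graphLinear a x - graphLinear a y‖ := by
    have := WithLp.norm_fst_le (p := 2) (x := graphLinear a x - graphLinear a y)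
    simpa [graphLinear_apply] using this
  have e3 : ‖(WithLp.toLp 2 ((0 : V), γ x - γ y - a (x - y)) : WithLp 2 (V × ℝ))‖
      = ‖γ x - γ y - a (x - y)‖ := by
    simp
  rw [e1, e3]
  refine h.trans ?_
  rcases le_or_gt 0 ε with hε | hε
  · gcongr
  · have h1 := (norm_nonneg _).trans h
    have : ‖x - y‖ = 0 := by nlinarith [norm_nonneg (x - y)]
    have hxy : x = y := sub_eq_zero.1 (norm_eq_zero.1 this)
    simp [hxy]

variable [FiniteDimensional ℝ V]

/-- With `g` the Riesz vector of `a`, the Gram operator is x ↦ x + a(x) g, a rank-one perturbation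
of the identity with determinant 1 + a(g) = 1 + ‖a‖². -/
theorem normDet_graphLinear (a : V →L[ℝ] ℝ) :
    (graphLinear a).normDet = √(1 + ‖a‖ ^ 2) := by
  set g := (InnerProductSpace.toDual ℝ V).symm a with hg
  have hga : ∀ x, a x = ⟪g, x⟫ := fun x => by
    rw [hg, InnerProductSpace.toDual_symm_apply]
  have hcomp : (graphLinear a).adjoint ∘ₗ graphLinear a
      = LinearMap.transvection a.toLinearMap g := by
    ext x
    refine ext_inner_left ℝ fun y => ?_
    rw [LinearMap.comp_apply, LinearMap.adjoint_inner_right, graphLinear_apply, graphLinear_apply,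
      WithLp.prod_inner_apply]
    simp only [LinearMap.transvection.apply, inner_add_right, inner_smul_right,
      ContinuousLinearMap.coe_coe]
    simp [hga, real_inner_comm]
  have hsq := (graphLinear a).normDet_sq
  rw [hcomp, LinearMap.transvection.det] at hsq
  have hn : a g = ‖a‖ ^ 2 := by
    rw [hga, real_inner_self_eq_norm_sq, hg, LinearIsometryEquiv.norm_map]
  rw [← Real.sqrt_sq (graphLinear a).normDet_nonneg]
  congr 1
  simpa [hn] using hsq

/-- On `s` the map `f` factors through `g` by a `K`-Lipschitz map: the hypothesis forces `f` to be
constant on the fibres of `g`, so any choice of preimages will do. -/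
theorem euclideanHausdorffMeasure_image_le_of_dist_le {X Y Z : Type*} [MetricSpace Y]
    [MeasurableSpace Y] [BorelSpace Y] [MetricSpace Z] [MeasurableSpace Z] [BorelSpace Z]
    {f : X → Y} {g : X → Z} {s : Set X} {K : ℝ≥0} (k : ℕ)
    (h : ∀ x ∈ s, ∀ y ∈ s, dist (f x) (f y) ≤ K * dist (g x) (g y)) :
    μHE[k] (f '' s) ≤ (K : ℝ≥0∞) ^ k * μHE[k] (g '' s) := by
  rcases s.eq_empty_or_nonempty with rfl | ⟨x₀, -⟩
  · simp
  have : Nonempty X := ⟨x₀⟩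
  set q : Z → X := Function.invFunOn g s
  have hq : ∀ x ∈ s, q (g x) ∈ s ∧ g (q (g x)) = g x := fun x hx =>
    ⟨Function.invFunOn_mem ⟨x, hx, rfl⟩, Function.invFunOn_eq ⟨x, hx, rfl⟩⟩
  have hfq : ∀ x ∈ s, f (q (g x)) = f x := fun x hx => by
    have := h _ (hq x hx).1 x hx
    rw [(hq x hx).2, dist_self, mul_zero] at this
    exact dist_le_zero.1 this
  have hlip : LipschitzOnWith K (f ∘ q) (g '' s) := by
    refine LipschitzOnWith.of_dist_le_mul ?_
    rintro _ ⟨x, hx, rfl⟩ _ ⟨y, hy, rfl⟩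
    simp only [Function.comp_apply, hfq x hx, hfq y hy]
    exact h x hx y hy
  have himg : f '' s = (f ∘ q) '' (g '' s) := by
    rw [image_image]
    exact image_congr fun x hx => (hfq x hx).symm
  have := hlip.hausdorffMeasure_image_le (d := k) (by positivity)
  rw [himg, euclideanHausdorffMeasure_def, euclideanHausdorffMeasure_def, Measure.smul_apply,
    Measure.smul_apply, nnreal_smul_coe_apply, nnreal_smul_coe_apply, mul_left_comm]
  gcongr
  simpa using this

/-- `ApproximatesLinearOn.norm_fderiv_sub_le` concerns maps from a space to itself. Multiplying by a
fixed unit vector `v` turns functionals into endomorphisms of the same norm. -/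
theorem ApproximatesLinearOn.ae_norm_fderiv_sub_le [MeasurableSpace V] [BorelSpace V]
    {γ : V → ℝ} {a : V →L[ℝ] ℝ} {s : Set V} {δ : ℝ≥0} (h : ApproximatesLinearOn γ a s δ)
    (hs : MeasurableSet s) (hd : ∀ x ∈ s, DifferentiableAt ℝ γ x) :
    ∀ᵐ x ∂(volume.restrict s), ‖fderiv ℝ γ x - a‖ ≤ δ := by
  rcases subsingleton_or_nontrivial V with hV | hV
  · refine Eventually.of_forall fun x => ?_
    rw [Subsingleton.elim (fderiv ℝ γ x - a) 0, norm_zero]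
    positivity
  obtain ⟨v, hv⟩ := exists_norm_eq V zero_le_one
  have hnorm : ∀ b : V →L[ℝ] ℝ, ‖b.smulRight v‖ = ‖b‖ := fun b => by
    rw [ContinuousLinearMap.norm_smulRight_apply, hv, mul_one]
  have key : ApproximatesLinearOn (fun x => γ x • v) (a.smulRight v) s δ := by
    intro x hx y hy
    rw [ContinuousLinearMap.smulRight_apply, ← sub_smul, ← sub_smul, norm_smul, hv, mul_one]
    exact h x hx y hy
  filter_upwards [key.norm_fderiv_sub_le volume hs (fun x => (fderiv ℝ γ x).smulRight v)
    fun x hx => ((hd x hx).hasFDerivAt.smul_const v).hasFDerivWithinAt] with x hx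
  have : (fderiv ℝ γ x).smulRight v - a.smulRight v = (fderiv ℝ γ x - a).smulRight v := by
    ext y; simp [sub_smul]
  rw [this] at hx
  rw [← hnorm]
  exact_mod_cast hx

theorem sqrt_one_add_sq_le_mul {x y ε : ℝ} (hε : 0 ≤ ε) (hx : 0 ≤ x)
    (h : x ≤ y + ε) : √(1 + x ^ 2) ≤ (1 + ε) * √(1 + y ^ 2) := by
  rw [Real.sqrt_le_left (by positivity), mul_pow, Real.sq_sqrt (by positivity)]
  have : x ^ 2 ≤ (y + ε) ^ 2 := by gcongr
  nlinarith [sq_nonneg (y - 1), mul_nonneg hε (sq_nonneg (y - 1)), sq_nonneg (ε * y)]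

variable [MeasurableSpace V] [BorelSpace V]

theorem measurableEmbedding_graphMap {γ : V → ℝ} (hγ : Continuous γ) :
    MeasurableEmbedding (graphMap γ) :=
  (continuous_graphMap hγ).measurableEmbedding (injective_graphMap γ)

/-- Two-sided area estimate on a set where `γ` is close to a linear functional. -/
theorem area_estimate {γ : V → ℝ} {a : V →L[ℝ] ℝ} {s : Set V} {ε : ℝ≥0} (hε : ε < 1)
    (h : ApproximatesLinearOn γ a s ε) (hs : MeasurableSet s)
    (hd : ∀ x ∈ s, DifferentiableAt ℝ γ x) :
    μHE[finrank ℝ V] (graphMap γ '' s) ≤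
        (1 + ε : ℝ≥0) ^ (finrank ℝ V + 1) * ∫⁻ x in s, ENNReal.ofReal (areaElement γ x) ∧
      ∫⁻ x in s, ENNReal.ofReal (areaElement γ x) ≤
        (1 + ε : ℝ≥0) * ((1 - ε)⁻¹ : ℝ≥0) ^ finrank ℝ V * μHE[finrank ℝ V] (graphMap γ '' s) := by
  set k := finrank ℝ V
  have hlin : μHE[k] (graphLinear a '' s) = ENNReal.ofReal √(1 + ‖a‖ ^ 2) * volume s := by
    rw [LinearMap.euclideanHausdorffMeasure_image_eq_normDet_mul_volume, normDet_graphLinear]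
  have hae := ApproximatesLinearOn.ae_norm_fderiv_sub_le h hs hd
  have hε0 : (0 : ℝ) ≤ ε := ε.2
  have hdist : ∀ x ∈ s, ∀ y ∈ s,
      ‖(graphMap γ x - graphMap γ y) - (graphLinear a x - graphLinear a y)‖
        ≤ ε * ‖graphLinear a x - graphLinear a y‖ := fun x hx y hy =>
    dist_graphMap_sub_le γ a (h x hx y hy)
  have up : μHE[k] (graphMap γ '' s) ≤ ((1 + ε : ℝ≥0) : ℝ≥0∞) ^ k * μHE[k] (graphLinear a '' s) := by
    refine euclideanHausdorffMeasure_image_le_of_dist_le k fun x hx y hy => ?_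
    rw [dist_eq_norm, dist_eq_norm]
    have h1 := hdist x hx y hy
    have h2 := norm_le_norm_add_norm_sub' (graphMap γ x - graphMap γ y)
      (graphLinear a x - graphLinear a y)
    push_cast
    linarith
  have low : μHE[k] (graphLinear a '' s) ≤
      (((1 - ε)⁻¹ : ℝ≥0) : ℝ≥0∞) ^ k * μHE[k] (graphMap γ '' s) := by
    refine euclideanHausdorffMeasure_image_le_of_dist_le k fun x hx y hy => ?_
    rw [dist_eq_norm, dist_eq_norm]
    have h1 := hdist x hx y hy
    have h2 := norm_le_norm_add_norm_sub (graphMap γ x - graphMap γ y)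
      (graphLinear a x - graphLinear a y)
    have h3 : (0 : ℝ) < 1 - ε := by
      have : (ε : ℝ) < 1 := by exact_mod_cast hε
      linarith
    rw [NNReal.coe_inv, NNReal.coe_sub hε.le, NNReal.coe_one, inv_mul_eq_div, le_div_iff₀ h3]
    nlinarith
  have e1 : ENNReal.ofReal √(1 + ‖a‖ ^ 2) * volume s ≤
      (1 + ε : ℝ≥0) * ∫⁻ x in s, ENNReal.ofReal (areaElement γ x) := by
    rw [← setLIntegral_const, ← lintegral_const_mul _ (measurable_areaElement γ).ennreal_ofReal]
    refine lintegral_mono_ae ?_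
    filter_upwards [hae] with x hx
    rw [← ENNReal.ofReal_coe_nnreal, ← ENNReal.ofReal_mul (by positivity)]
    refine ENNReal.ofReal_le_ofReal ?_
    push_cast
    refine sqrt_one_add_sq_le_mul hε0 (norm_nonneg _) ?_
    have := norm_le_norm_add_norm_sub (fderiv ℝ γ x) a
    linarith
  have e2 : ∫⁻ x in s, ENNReal.ofReal (areaElement γ x) ≤
      (1 + ε : ℝ≥0) * (ENNReal.ofReal √(1 + ‖a‖ ^ 2) * volume s) := by
    rw [← mul_assoc, ← setLIntegral_const]
    refine lintegral_mono_ae ?_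
    filter_upwards [hae] with x hx
    rw [← ENNReal.ofReal_coe_nnreal, ← ENNReal.ofReal_mul (by positivity)]
    refine ENNReal.ofReal_le_ofReal ?_
    push_cast
    refine sqrt_one_add_sq_le_mul hε0 (norm_nonneg _) ?_
    have := norm_le_norm_add_norm_sub' (fderiv ℝ γ x) a
    linarith
  rw [hlin] at up low
  constructor
  · calc _ ≤ _ := up
      _ ≤ ((1 + ε : ℝ≥0) : ℝ≥0∞) ^ k *
          ((1 + ε : ℝ≥0) * ∫⁻ x in s, ENNReal.ofReal (areaElement γ x)) := by gcongr
      _ = _ := by rw [pow_succ, mul_assoc]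
  · calc _ ≤ _ := e2
      _ ≤ (1 + ε : ℝ≥0) * ((((1 - ε)⁻¹ : ℝ≥0) : ℝ≥0∞) ^ k * μHE[k] (graphMap γ '' s)) := by gcongr
      _ = _ := by rw [mul_assoc]

theorem euclideanHausdorffMeasure_graphMap_image_of_null {γ : V → ℝ} {K : ℝ≥0}
    (hγ : LipschitzWith K γ) {s : Set V} (hs : volume s = 0) :
    μHE[finrank ℝ V] (graphMap γ '' s) = 0 := by
  have h := euclideanHausdorffMeasure_image_le_of_dist_le (f := graphMap γ) (g := id) (s := s)
    (K := 1 + K) (finrank ℝ V) fun x _ y _ => by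
      have h1 : ‖graphMap γ x - graphMap γ y‖ ≤ ‖x - y‖ + ‖γ x - γ y‖ := by
        have e : graphMap γ x - graphMap γ y
            = WithLp.toLp 2 (x - y, (0 : ℝ)) + WithLp.toLp 2 ((0 : V), γ x - γ y) := by
          rw [graphMap, graphMap, ← WithLp.toLp_sub, ← WithLp.toLp_add]
          simp
        rw [e]
        refine (norm_add_le _ _).trans (le_of_eq ?_)
        simp
      have h2 := hγ.dist_le_mul x y
      rw [dist_eq_norm, dist_eq_norm] at h2
      rw [dist_eq_norm, id, id, dist_eq_norm]
      push_cast
      linarith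
  rw [image_id, InnerProductSpace.euclideanHausdorffMeasure_eq_volume, hs, mul_zero] at h
  exact le_antisymm h zero_le

/-- **Area formula** for the graph of a Lipschitz function. -/
theorem euclideanHausdorffMeasure_graphMap_image {γ : V → ℝ} {K : ℝ≥0}
    (hγ : LipschitzWith K γ) {s : Set V} (hs : MeasurableSet s) :
    μHE[finrank ℝ V] (graphMap γ '' s) = ∫⁻ x in s, ENNReal.ofReal (areaElement γ x) := by
  set k := finrank ℝ V
  set d : Set V := {x | DifferentiableAt ℝ γ x}
  have hdm : MeasurableSet d := measurableSet_of_differentiableAt ℝ γ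
  have hdn : volume dᶜ = 0 := hγ.ae_differentiableAt
  have hcover : ∀ ε : ℝ≥0, 0 < ε → ∃ (u : ℕ → Set V) (A : ℕ → V →L[ℝ] ℝ),
      Pairwise (Function.onFun Disjoint u) ∧ (∀ n, MeasurableSet (u n)) ∧ (⋃ n, u n) = s ∩ d ∧
        ∀ n, ApproximatesLinearOn γ (A n) (u n) ε := by
    intro ε hε
    obtain ⟨t, A, t1, t2, t3, t4, -⟩ := exists_partition_approximatesLinearOn_of_hasFDerivWithinAt
      γ (s ∩ d) (fderiv ℝ γ) (fun x hx => (show DifferentiableAt ℝ γ x from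
        hx.2).hasFDerivAt.hasFDerivWithinAt) (fun _ => ε) fun _ => hε.ne'
    refine ⟨fun n => s ∩ d ∩ t n, A, fun i j hij => ?_, fun n => (hs.inter hdm).inter (t2 n), ?_, t4⟩
    · exact (t1 hij).mono inter_subset_right inter_subset_right
    · rw [← inter_iUnion, inter_eq_left.2 t3]
  -- By Rademacher the non-differentiability set is null, and a Lipschitz graph map sends it to a
  -- null set.
  have hsplitH : μHE[k] (graphMap γ '' s) = μHE[k] (graphMap γ '' (s ∩ d)) := by
    refine le_antisymm ?_ (measure_mono (image_mono inter_subset_left))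
    have : graphMap γ '' s ⊆ graphMap γ '' (s ∩ d) ∪ graphMap γ '' dᶜ := by
      rw [← image_union]
      refine image_mono fun x hx => ?_
      by_cases hxd : x ∈ d
      · exact Or.inl ⟨hx, hxd⟩
      · exact Or.inr hxd
    refine (measure_mono this).trans ((measure_union_le _ _).trans ?_)
    rw [euclideanHausdorffMeasure_graphMap_image_of_null hγ hdn, add_zero]
  have hsplitI : ∫⁻ x in s, ENNReal.ofReal (areaElement γ x)
      = ∫⁻ x in s ∩ d, ENNReal.ofReal (areaElement γ x) :=
    setLIntegral_congr (inter_ae_eq_left_of_ae_eq_univ (eventuallyEq_univ.2 hγ.ae_differentiableAt)).symm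
  rw [hsplitH, hsplitI]
  have hsum : ∀ (u : ℕ → Set V), Pairwise (Function.onFun Disjoint u) → (∀ n, MeasurableSet (u n)) →
      (⋃ n, u n) = s ∩ d →
      μHE[k] (graphMap γ '' (s ∩ d)) = ∑' n, μHE[k] (graphMap γ '' (u n)) ∧
      ∫⁻ x in s ∩ d, ENNReal.ofReal (areaElement γ x)
        = ∑' n, ∫⁻ x in u n, ENNReal.ofReal (areaElement γ x) := by
    intro u u1 u2 u3
    rw [← u3]
    refine ⟨?_, lintegral_iUnion u2 u1 _⟩
    rw [image_iUnion, measure_iUnion]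
    · exact fun i j hij => (disjoint_image_iff (injective_graphMap γ)).2 (u1 hij)
    · exact fun n => (measurableEmbedding_graphMap hγ.continuous).measurableSet_image.2 (u2 n)
  set H := μHE[k] (graphMap γ '' (s ∩ d))
  set I := ∫⁻ x in s ∩ d, ENNReal.ofReal (areaElement γ x)
  -- The factors in `area_estimate` do not depend on the piece, so the estimates sum over the
  -- partition; both factors tend to 1 as ε → 0.
  have hest : ∀ ε : ℝ≥0, 0 < ε → ε < 1 → H ≤ ((1 + ε : ℝ≥0) ^ (k + 1) : ℝ≥0) * I ∧
      I ≤ ((1 + ε) * (1 - ε)⁻¹ ^ k : ℝ≥0) * H := by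
    intro ε hε hε1
    obtain ⟨u, A, u1, u2, u3, u4⟩ := hcover ε hε
    obtain ⟨hH, hI⟩ := hsum u u1 u2 u3
    have hd : ∀ n, ∀ x ∈ u n, DifferentiableAt ℝ γ x := fun n x hx =>
      (u3 ▸ mem_iUnion_of_mem n hx : x ∈ s ∩ d).2
    rw [hH, hI, ← ENNReal.tsum_mul_left, ← ENNReal.tsum_mul_left]
    push_cast [ENNReal.coe_pow, ENNReal.coe_mul]
    refine ⟨ENNReal.tsum_le_tsum fun n => ?_, ENNReal.tsum_le_tsum fun n => ?_⟩
    · exact_mod_cast (area_estimate hε1 (u4 n) (u2 n) (hd n)).1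
    · exact_mod_cast (area_estimate hε1 (u4 n) (u2 n) (hd n)).2
  have hev : ∀ᶠ ε in 𝓝[>] (0 : ℝ≥0), 0 < ε ∧ ε < 1 :=
    (eventually_mem_nhdsWithin).and (nhdsWithin_le_nhds (eventually_lt_nhds one_pos))
  have hlim : ∀ (f : ℝ≥0 → ℝ≥0) (X : ℝ≥0∞), ContinuousAt f 0 → f 0 = 1 →
      Tendsto (fun ε => (f ε : ℝ≥0∞) * X) (𝓝[>] 0) (𝓝 X) := by
    intro f X hf h0
    have h1 : Tendsto (fun ε => (f ε : ℝ≥0∞)) (𝓝[>] 0) (𝓝 1) := by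
      have := (ENNReal.tendsto_coe.2 hf.tendsto).mono_left (nhdsWithin_le_nhds (s := Ioi 0))
      rwa [h0] at this
    simpa using ENNReal.Tendsto.mul_const h1 (Or.inl one_ne_zero)
  refine le_antisymm ?_ ?_
  · refine ge_of_tendsto (hlim (fun ε => (1 + ε) ^ (k + 1)) I (by fun_prop) (by simp)) ?_
    filter_upwards [hev] with ε hε using (hest ε hε.1 hε.2).1
  · refine ge_of_tendsto (hlim (fun ε => (1 + ε) * (1 - ε)⁻¹ ^ k) H ?_ (by simp)) ?_
    · have : ContinuousAt (fun ε : ℝ≥0 => (1 - ε)⁻¹) 0 :=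
        ContinuousAt.inv₀ (by fun_prop) (by simp)
      exact (by fun_prop : ContinuousAt (fun ε : ℝ≥0 => 1 + ε) 0).mul (this.pow k)
    · filter_upwards [hev] with ε hε using (hest ε hε.1 hε.2).2

end AreaFormula

/-! ### Lipschitz test functions for weakly divergence free fields. -/

section WeakDivergence

open scoped Convolution

/-- The divergence of `F` vanishes on `D` in the sense of distributions. -/
def WeaklyDivFree {d : ℕ} (D : Set (E d)) (F : E d → E d) : Prop :=
  ∀ ψ : E d → ℝ, ContDiff ℝ ∞ ψ → HasCompactSupport ψ → tsupport ψ ⊆ D →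
    ∫ x in D, ⟪F x, ∇ ψ x⟫ = 0

variable {d : ℕ}

theorem inner_gradient_eq_fderiv (f : E d → ℝ) (x v : E d) : ⟪∇ f x, v⟫ = fderiv ℝ f x v := by
  rw [gradient, InnerProductSpace.toDual_symm_apply]

theorem inner_gradient_eq_lineDeriv {f : E d → ℝ} {x : E d} (hf : DifferentiableAt ℝ f x)
    (v : E d) : ⟪∇ f x, v⟫ = lineDeriv ℝ f x v := by
  rw [inner_gradient_eq_fderiv, hf.lineDeriv_eq_fderiv]

theorem measurable_gradient (f : E d → ℝ) : Measurable (∇ f) :=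
  (InnerProductSpace.toDual ℝ (E d)).symm.continuous.measurable.comp (measurable_fderiv ℝ f)

/-- Derivatives of a mollified Lipschitz function are the mollified derivatives. -/
theorem lineDeriv_convolution_lipschitz {f g : E d → ℝ} {K : ℝ≥0} (hf : ContDiff ℝ ∞ f)
    (hfc : HasCompactSupport f) (hg : LipschitzWith K g) (hgc : HasCompactSupport g) (x v : E d) :
    fderiv ℝ (f ⋆[ContinuousLinearMap.lsmul ℝ ℝ, volume] g) x v =
      (f ⋆[ContinuousLinearMap.lsmul ℝ ℝ, volume] fun y => lineDeriv ℝ g y v) x := by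
  have hf1 : ContDiff ℝ 1 f := hf.of_le (by simp)
  have hgl : LocallyIntegrable g volume := hg.continuous.locallyIntegrable
  rw [(hfc.hasFDerivAt_convolution_left (ContinuousLinearMap.lsmul ℝ ℝ) hf1 hgl x).fderiv,
    convolution_def, convolution_def, ContinuousLinearMap.integral_apply]
  swap
  · exact (hfc.fderiv ℝ).convolutionExists_left _ (hf1.continuous_fderiv one_ne_zero) hgl x
  obtain ⟨C, hC⟩ := hf.lipschitzWith_of_hasCompactSupport hfc (by simp)
  have hsub : LipschitzWith (K * 1) (fun t => g (x - t)) :=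
    hg.comp (LipschitzWith.of_dist_le_mul fun a b => by rw [dist_sub_left]; simp)
  have hsubc : HasCompactSupport (fun t => g (x - t)) :=
    hgc.comp_homeomorph (Homeomorph.subLeft x)
  -- Integration by parts puts the direction `-v` on `t ↦ g (x - t)`; the reflection turns it back
  -- into `v`.
  have := LipschitzWith.integral_lineDeriv_mul_eq (μ := volume) hC hsub hsubc v
  calc _ = ∫ t, lineDeriv ℝ f t v * g (x - t) := by
        refine integral_congr_ae (Eventually.of_forall fun t => ?_)
        simp only [(hf1.differentiable one_ne_zero t).lineDeriv_eq_fderiv]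
        simp [ContinuousLinearMap.precompL_apply]
    _ = _ := this
    _ = _ := by
        refine integral_congr_ae (Eventually.of_forall fun t => ?_)
        simp only [ContinuousLinearMap.lsmul_apply, smul_eq_mul, mul_comm (f t)]
        congr 1
        simp only [lineDeriv]
        congr 1
        ext s
        congr 1
        module

/-- Mollifications of `g` are smooth test functions. Their directional derivatives are bounded by
the Lipschitz constant and converge almost everywhere, so dominated convergence applies with `F`
merely integrable. -/
theorem WeaklyDivFree.integral_inner_gradient_lipschitz {D : Set (E d)} {F : E d → E d}
    (hdiv : WeaklyDivFree D F) (hD : IsOpen D) (hF : IntegrableOn F D) {g : E d → ℝ} {K : ℝ≥0}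
    (hg : LipschitzWith K g) (hgc : HasCompactSupport g) (hgs : tsupport g ⊆ D) :
    ∫ x in D, ⟪F x, ∇ g x⟫ = 0 := by
  obtain ⟨δ, hδ, hδD⟩ := hgc.isCompact.exists_cthickening_subset_open hD hgs
  have hn : ∀ n : ℕ, (0 : ℝ) < n + 1 := fun n => by positivity
  -- The outer radius stays below `δ`, keeping supports in `D`. The fixed ratio 2 of the radii is
  -- what almost everywhere convergence of the convolutions asks for.
  let κ : ℕ → ContDiffBump (0 : E d) := fun n =>
    ⟨δ / (2 * (n + 1)), δ / (n + 1), by have := hn n; positivity, by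
      have := hn n
      gcongr
      linarith⟩
  have hκle : ∀ n, (κ n).rOut ≤ δ := fun n => by
    refine div_le_self hδ.le ?_
    have : (0 : ℝ) ≤ n := n.cast_nonneg
    linarith
  let ψ : ℕ → E d → ℝ := fun n =>
    (κ n).normed volume ⋆[ContinuousLinearMap.lsmul ℝ ℝ, volume] g
  have hκs : ∀ n, ContDiff ℝ ∞ ((κ n).normed volume) := fun n => (κ n).contDiff_normed
  have hκc : ∀ n, HasCompactSupport ((κ n).normed volume) := fun n => (κ n).hasCompactSupport_normed
  have hgl : LocallyIntegrable g volume := hg.continuous.locallyIntegrable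
  have hψs : ∀ n, ContDiff ℝ ∞ (ψ n) := fun n => (hκc n).contDiff_convolution_left _ (hκs n) hgl
  have hψc : ∀ n, HasCompactSupport (ψ n) := fun n => (hκc n).convolution _ hgc
  have hψD : ∀ n, tsupport (ψ n) ⊆ D := fun n => by
    refine (closure_minimal ?_ Metric.isClosed_cthickening).trans hδD
    refine (support_convolution_subset _).trans ?_
    rintro _ ⟨a, ha, b, hb, rfl⟩
    rw [(κ n).support_normed_eq] at ha
    refine Metric.mem_cthickening_of_dist_le (a + b) b δ _ (subset_tsupport _ hb) ?_
    have : ‖a‖ < (κ n).rOut := by simpa using ha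
    simp only [dist_eq_norm, add_sub_cancel_right]
    linarith [hκle n]
  have hψder : ∀ n x v, ⟪∇ (ψ n) x, v⟫ = ((κ n).normed volume
      ⋆[ContinuousLinearMap.lsmul ℝ ℝ, volume] fun y => lineDeriv ℝ g y v) x := fun n x v => by
    rw [inner_gradient_eq_fderiv]
    exact lineDeriv_convolution_lipschitz (hκs n) (hκc n) hg hgc x v
  have hψbd : ∀ n x v, ‖⟪∇ (ψ n) x, v⟫‖ ≤ K * ‖v‖ := fun n x v => by
    rw [hψder, convolution_def]
    have hint : Integrable ((κ n).normed volume) volume :=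
      (hκs n).continuous.integrable_of_hasCompactSupport (hκc n)
    refine (norm_integral_le_of_norm_le (hint.mul_const (K * ‖v‖))
      (Eventually.of_forall fun t => ?_)).trans (le_of_eq ?_)
    · rw [ContinuousLinearMap.lsmul_apply, norm_smul, Real.norm_of_nonneg ((κ n).nonneg_normed t)]
      exact mul_le_mul_of_nonneg_left (norm_lineDeriv_le_of_lipschitz ℝ hg)
        ((κ n).nonneg_normed t)
    · rw [integral_mul_const, (κ n).integral_normed, one_mul]
  have hlim : ∀ v, ∀ᵐ x, Tendsto (fun n => ⟪∇ (ψ n) x, v⟫) atTop (𝓝 ⟪∇ g x, v⟫) := fun v => by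
    have hr : Tendsto (fun n => (κ n).rOut) atTop (𝓝 0) := by
      simpa [κ, div_eq_mul_inv] using tendsto_one_div_add_atTop_nhds_zero_nat.const_mul δ
    filter_upwards [ContDiffBump.ae_convolution_tendsto_right_of_locallyIntegrable (K := 2) hr
      (Eventually.of_forall fun n => le_of_eq (by
        have := (hn n).ne'
        change δ / (n + 1) = 2 * (δ / (2 * (n + 1)))
        field_simp)) (hg.locallyIntegrable_lineDeriv (μ := volume) v),
      hg.ae_differentiableAt (μ := volume)] with x hx hdx
    rw [inner_gradient_eq_lineDeriv hdx]
    exact hx.congr fun n => (hψder n x v).symm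
  -- The exceptional null set depends on the direction, so only the finitely many basis directions
  -- are used.
  let b := stdOrthonormalBasis ℝ (E d)
  have hbsum : ∀ u w : E d, ⟪u, w⟫ = ∑ i, ⟪u, b i⟫ * ⟪w, b i⟫ := fun u w => by
    rw [← b.sum_inner_mul_inner u w]
    simp [real_inner_comm]
  have hconv : Tendsto (fun n => ∫ x in D, ⟪F x, ∇ (ψ n) x⟫) atTop (𝓝 (∫ x in D, ⟪F x, ∇ g x⟫)) := by
    refine tendsto_integral_of_dominated_convergence (fun x => ∑ i : Fin _, ‖F x‖ * ‖b i‖ * (K * ‖b i‖))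
      (fun n => hF.aestronglyMeasurable.inner (measurable_gradient _).aestronglyMeasurable)
      (integrable_finsetSum _ fun i _ => (hF.norm.mul_const _).mul_const _) (fun n => ?_) ?_
    · refine Eventually.of_forall fun x => ?_
      rw [hbsum]
      refine (norm_sum_le _ _).trans (Finset.sum_le_sum fun i _ => ?_)
      rw [norm_mul]
      exact mul_le_mul (norm_inner_le_norm _ _) (hψbd n x (b i)) (norm_nonneg _) (by positivity)
    · refine ae_restrict_of_ae ?_
      filter_upwards [ae_all_iff.2 fun i => hlim (b i)] with x hx
      rw [hbsum (F x) (∇ g x)]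
      refine Tendsto.congr (fun n => (hbsum _ _).symm) ?_
      exact tendsto_finsetSum _ fun i _ => (hx i).const_mul _
  refine tendsto_nhds_unique hconv ?_
  simp only [hdiv _ (hψs _) (hψc _) (hψD _)]
  exact tendsto_const_nhds

/-- A compactly supported locally Lipschitz function is Lipschitz. -/
theorem exists_lipschitzWith_of_hasCompactSupport {g : E d → ℝ} (hg : LocallyLipschitz g)
    (hc : HasCompactSupport g) : ∃ K, LipschitzWith K g := by
  obtain ⟨R, hR⟩ := hc.isCompact.isBounded.subset_closedBall (0 : E d)
  obtain ⟨K, hK⟩ := LocallyLipschitzOn.exists_lipschitzOnWith_of_compact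
    (isCompact_closedBall (0 : E d) (R + 1)) hg.locallyLipschitzOn
  obtain ⟨M, hM⟩ := hc.exists_bound_of_continuous hg.continuous
  have hM0 : 0 ≤ M := (norm_nonneg _).trans (hM 0)
  have hzero : ∀ y : E d, R < ‖y‖ → g y = 0 := fun y hy => by
    by_contra h
    have := hR (subset_tsupport _ h)
    rw [mem_closedBall_zero_iff] at this
    linarith
  -- If both points lie in the ball of radius R + 1, `K` suffices. Otherwise `g y = 0`, and `g x`
  -- either vanishes or lies at distance at least 1, where the bound `M` suffices.
  have key : ∀ x y : E d, ‖x‖ ≤ ‖y‖ → dist (g x) (g y) ≤ (K + M.toNNReal : ℝ≥0) * dist x y := by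
    intro x y hxy
    push_cast
    rw [Real.coe_toNNReal M hM0]
    have hd := dist_nonneg (x := x) (y := y)
    rcases le_or_gt ‖y‖ (R + 1) with hy | hy
    · have := hK.dist_le_mul x (by simpa using hxy.trans hy) y (by simpa using hy)
      nlinarith
    · have hgy : g y = 0 := hzero y (by linarith)
      rcases le_or_gt ‖x‖ R with hx | hx
      · have h1 : 1 ≤ dist x y := by
          have := norm_sub_norm_le y x
          rw [dist_comm, dist_eq_norm]
          linarith
        rw [hgy, dist_zero_right]
        have := hM x
        have h2 : (0 : ℝ) ≤ K := K.2
        nlinarith [mul_nonneg h2 hd]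
      · rw [hzero x hx, hgy, dist_self]
        have : (0 : ℝ) ≤ K := K.2
        positivity
  refine ⟨K + M.toNNReal, LipschitzWith.of_dist_le_mul fun x y => ?_⟩
  rcases le_total ‖x‖ ‖y‖ with h | h
  · exact key x y h
  · rw [dist_comm, dist_comm x]
    exact key y x h

theorem exists_lipschitzOnWith_mul_nhds {f g : E d → ℝ} {x : E d} {K L : ℝ≥0} {s t : Set (E d)}
    (hs : s ∈ 𝓝 x) (ht : t ∈ 𝓝 x) (hf : LipschitzOnWith K f s) (hg : LipschitzOnWith L g t) :
    ∃ M, ∃ u ∈ 𝓝 x, LipschitzOnWith M (fun y => f y * g y) u := by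
  have hfb : ∀ᶠ y in 𝓝 x, ‖f y‖ < ‖f x‖ + 1 :=
    (hf.continuousOn.continuousAt hs).norm.eventually_lt continuousAt_const (lt_add_one _)
  have hgb : ∀ᶠ y in 𝓝 x, ‖g y‖ < ‖g x‖ + 1 :=
    (hg.continuousOn.continuousAt ht).norm.eventually_lt continuousAt_const (lt_add_one _)
  refine ⟨(‖f x‖₊ + 1) * L + (‖g x‖₊ + 1) * K, _,
    inter_mem (inter_mem hs ht) (inter_mem hfb hgb), LipschitzOnWith.of_dist_le_mul ?_⟩
  rintro y ⟨⟨hys, hyt⟩, hyf, hyg⟩ z ⟨⟨hzs, hzt⟩, hzf, hzg⟩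
  have h1 := hf.dist_le_mul y hys z hzs
  have h2 := hg.dist_le_mul y hyt z hzt
  have e : f y * g y - f z * g z = f y * (g y - g z) + g z * (f y - f z) := by ring
  have hyf' : ‖f y‖ ≤ ‖f x‖ + 1 := le_of_lt hyf
  have hzg' : ‖g z‖ ≤ ‖g x‖ + 1 := le_of_lt hzg
  rw [dist_eq_norm] at h1 h2
  rw [dist_eq_norm, e]
  refine (norm_add_le _ _).trans ?_
  rw [norm_mul, norm_mul]
  push_cast
  have a1 := mul_le_mul hyf' h2 (norm_nonneg _) (by positivity)
  have a2 := mul_le_mul hzg' h1 (norm_nonneg _) (by positivity)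
  nlinarith

theorem gradient_mul_of_differentiableAt {f g : E d → ℝ} {x : E d} (hf : DifferentiableAt ℝ f x)
    (hg : DifferentiableAt ℝ g x) :
    ∇ (fun y => f y * g y) x = f x • ∇ g x + g x • ∇ f x := by
  simp only [gradient, fderiv_fun_mul hf hg, map_add, map_smul]

theorem contDiffAt_one_of_continuousOn_gradient {D : Set (E d)} (hD : IsOpen D) {φ : E d → ℝ}
    (hφ : ∀ x ∈ D, DifferentiableAt ℝ φ x) (hφ' : ContinuousOn (∇ φ) D) {x : E d} (hx : x ∈ D) :
    ContDiffAt ℝ 1 φ x :=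
  contDiffAt_one_iff.2 ⟨fun y => InnerProductSpace.toDual ℝ (E d) (∇ φ y), D, hD.mem_nhds hx,
    (InnerProductSpace.toDual ℝ (E d)).continuous.comp_continuousOn hφ',
    fun y hy => (hφ y hy).hasGradientAt.hasFDerivAt⟩

/-- A weakly divergence free field tested against the product of a Lipschitz cut-off, compactly
supported in `D`, and a function of class `C¹` on `D`. -/
theorem WeaklyDivFree.integral_cutoff {D : Set (E d)} {F : E d → E d}
    (hdiv : WeaklyDivFree D F) (hD : IsOpen D) (hF : IntegrableOn F D) {φ : E d → ℝ}
    (hφ : ∀ x ∈ D, DifferentiableAt ℝ φ x) (hφ' : ContinuousOn (∇ φ) D)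
    {c : E d → ℝ} {K : ℝ≥0} (hc : LipschitzWith K c) (hcc : HasCompactSupport c)
    (hcs : tsupport c ⊆ D) :
    ∫ x in D, (c x * ⟪F x, ∇ φ x⟫ + φ x * ⟪F x, ∇ c x⟫) = 0 := by
  have hsupp : tsupport (fun y => c y * φ y) ⊆ tsupport c := tsupport_mul_subset_left
  have hgc : HasCompactSupport (fun y => c y * φ y) := hcc.mul_right
  -- Nothing is known of `φ` outside `D`, but there the product vanishes in a neighbourhood of each
  -- point.
  have hloc : LocallyLipschitz (fun y => c y * φ y) := by
    intro x
    by_cases hx : x ∈ D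
    · obtain ⟨L, t, ht, hL⟩ :=
        (contDiffAt_one_of_continuousOn_gradient hD hφ hφ' hx).exists_lipschitzOnWith
      exact exists_lipschitzOnWith_mul_nhds univ_mem ht (hc.lipschitzOnWith) hL
    · have hx' : x ∉ tsupport c := fun h => hx (hcs h)
      refine ⟨0, _, notMem_tsupport_iff_eventuallyEq.1 hx', ?_⟩
      intro y hy z hz
      have hy' : c y = 0 := hy
      have hz' : c z = 0 := hz
      simp [hy', hz']
  obtain ⟨L, hL⟩ := exists_lipschitzWith_of_hasCompactSupport hloc hgc
  rw [← hdiv.integral_inner_gradient_lipschitz hD hF hL hgc (hsupp.trans hcs)]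
  refine setIntegral_congr_ae hD.measurableSet ?_
  filter_upwards [hc.ae_differentiableAt (μ := volume)] with x hcx hx
  rw [gradient_mul_of_differentiableAt hcx (hφ x hx), inner_add_right, inner_smul_right,
    inner_smul_right]

end WeakDivergence

/-! ### Boundary charts: height, normal, surface measure and volume. -/

section Chart

open Measure Module
open scoped ENNReal

variable {d k : ℕ} (e : E d ≃ₗᵢ[ℝ] WithLp 2 (E k × ℝ)) (γ : E k → ℝ)

/-- The height of `y` above the graph of `γ`, in the coordinates `e`. -/
def height (y : E d) : ℝ := (e y).snd - γ (e y).fst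

/-- The point at height `s` above the point of the graph of `γ` with abscissa `x`. -/
def pointAbove (x : E k) (s : ℝ) : E d := e.symm (WithLp.toLp 2 (x, γ x + s))

/-- The upward normal `(-∇γ, 1)` to the graph of `γ`, not normalised. -/
def upwardNormal (x : E k) : E d := e.symm (WithLp.toLp 2 (-∇ γ x, (1 : ℝ)))

/-- The set `D` agrees on the open set `U` with the epigraph of the Lipschitz function `γ`, in the
coordinates `e`. -/
structure IsEpigraphOn (D U : Set (E d)) (K : ℝ≥0) : Prop where
  lipschitz : LipschitzWith K γ
  isOpen : IsOpen U
  mem_iff : ∀ y ∈ U, y ∈ D ↔ 0 < height e γ y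

variable {γ}

theorem pointAbove_zero (x : E k) : pointAbove e γ x 0 = e.symm (graphMap γ x) := by
  simp [pointAbove, graphMap]

theorem height_pointAbove (x : E k) (s : ℝ) : height e γ (pointAbove e γ x s) = s := by
  simp [height, pointAbove]

theorem pointAbove_fst_height (y : E d) : pointAbove e γ (e y).fst (height e γ y) = y := by
  rw [pointAbove, height, add_sub_cancel, LinearIsometryEquiv.symm_apply_eq]
  rfl

theorem fst_pointAbove (x : E k) (s : ℝ) : (e (pointAbove e γ x s)).fst = x := by
  simp [pointAbove]

theorem norm_le_norm_pointAbove (x : E k) (s : ℝ) : ‖x‖ ≤ ‖pointAbove e γ x s‖ := by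
  rw [pointAbove, LinearIsometryEquiv.norm_map]
  exact WithLp.norm_fst_le (p := 2) (x := WithLp.toLp 2 (x, γ x + s))

theorem continuous_fst_coord : Continuous fun y : E d => (e y).fst :=
  (WithLp.fstL 2 ℝ (E k) ℝ).continuous.comp e.continuous

theorem continuous_pointAbove (hγ : Continuous γ) :
    Continuous fun p : E k × ℝ => pointAbove e γ p.1 p.2 :=
  e.symm.continuous.comp ((WithLp.prod_continuous_toLp 2 (E k) ℝ).comp
    (continuous_fst.prodMk ((hγ.comp continuous_fst).add continuous_snd)))

theorem norm_fst_coord_sub_le (y z : E d) : ‖(e y).fst - (e z).fst‖ ≤ ‖y - z‖ := by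
  rw [← e.norm_map (y - z), map_sub]
  exact WithLp.norm_fst_le (p := 2) (x := e y - e z)

theorem norm_snd_coord_sub_le (y z : E d) : ‖(e y).snd - (e z).snd‖ ≤ ‖y - z‖ := by
  rw [← e.norm_map (y - z), map_sub]
  exact WithLp.norm_snd_le (p := 2) (x := e y - e z)

theorem lipschitzWith_height {K : ℝ≥0} (hγ : LipschitzWith K γ) :
    LipschitzWith (1 + K) (height e γ) := by
  refine LipschitzWith.of_dist_le_mul fun y z => ?_
  have h1 := norm_snd_coord_sub_le e y z
  have h2 := norm_fst_coord_sub_le e y z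
  have h3 := hγ.dist_le_mul (e y).fst (e z).fst
  rw [dist_eq_norm, dist_eq_norm] at h3
  rw [dist_eq_norm, dist_eq_norm, height, height]
  have e1 : (e y).snd - γ (e y).fst - ((e z).snd - γ (e z).fst)
      = ((e y).snd - (e z).snd) - (γ (e y).fst - γ (e z).fst) := by ring
  rw [e1]
  refine (norm_sub_le _ _).trans ?_
  push_cast
  nlinarith [K.2, norm_nonneg (y - z)]

/-- With this, Rademacher's theorem for the height in `E d` yields differentiability of `γ` below
almost every point, without a Fubini argument. -/
theorem differentiableAt_of_height {y : E d} (h : DifferentiableAt ℝ (height e γ) y) :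
    DifferentiableAt ℝ γ (e y).fst := by
  set t := (e y).snd
  have hφ : ∀ x : E k, γ x = t - height e γ (e.symm (WithLp.toLp 2 (x, t))) := fun x => by
    simp [height]
  have hy : e.symm (WithLp.toLp 2 ((e y).fst, t)) = y := by
    rw [LinearIsometryEquiv.symm_apply_eq]; rfl
  have hd : DifferentiableAt ℝ (fun x : E k => e.symm (WithLp.toLp 2 (x, t))) (e y).fst := by
    have h1 : Differentiable ℝ fun x : E k => (WithLp.toLp 2 (x, t) : WithLp 2 (E k × ℝ)) :=
      (WithLp.prodContinuousLinearEquiv 2 ℝ (E k) ℝ).symm.differentiable.comp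
        (differentiable_id.prodMk (differentiable_const t))
    exact (e.symm.toContinuousLinearEquiv.differentiable.comp h1) _
  rw [funext hφ]
  refine (differentiableAt_const t).sub ?_
  exact DifferentiableAt.comp (g := height e γ) (e y).fst (by rw [hy]; exact h) hd

theorem gradient_height {y : E d} (h : DifferentiableAt ℝ γ (e y).fst) :
    ∇ (height e γ) y = upwardNormal e γ (e y).fst := by
  refine HasGradientAt.gradient (hasGradientAt_iff_hasFDerivAt.2 ?_)
  have h1 : HasFDerivAt (fun y : E d => (e y).fst)
      ((ContinuousLinearMap.fst ℝ (E k) ℝ).comp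
        ((WithLp.prodContinuousLinearEquiv 2 ℝ (E k) ℝ).toContinuousLinearMap.comp
        e.toContinuousLinearEquiv.toContinuousLinearMap)) y :=
    ((ContinuousLinearMap.fst ℝ (E k) ℝ).comp
        ((WithLp.prodContinuousLinearEquiv 2 ℝ (E k) ℝ).toContinuousLinearMap.comp
        e.toContinuousLinearEquiv.toContinuousLinearMap)).hasFDerivAt
  have h2 : HasFDerivAt (fun y : E d => (e y).snd)
      ((ContinuousLinearMap.snd ℝ (E k) ℝ).comp
        ((WithLp.prodContinuousLinearEquiv 2 ℝ (E k) ℝ).toContinuousLinearMap.comp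
        e.toContinuousLinearEquiv.toContinuousLinearMap)) y :=
    ((ContinuousLinearMap.snd ℝ (E k) ℝ).comp
        ((WithLp.prodContinuousLinearEquiv 2 ℝ (E k) ℝ).toContinuousLinearMap.comp
        e.toContinuousLinearEquiv.toContinuousLinearMap)).hasFDerivAt
  have h3 := h2.sub (HasFDerivAt.comp y h.hasFDerivAt h1)
  refine h3.congr_fderiv ?_
  ext v
  rw [InnerProductSpace.toDual_apply_apply, upwardNormal, ← e.inner_map_map,
    LinearIsometryEquiv.apply_symm_apply, WithLp.prod_inner_apply]
  simp only [inner_neg_left, inner_gradient_eq_fderiv]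
  simp
  ring

theorem norm_upwardNormal (x : E k) : ‖upwardNormal e γ x‖ = areaElement γ x := by
  rw [upwardNormal, LinearIsometryEquiv.norm_map, WithLp.prod_norm_eq_of_L2, areaElement]
  simp [gradient, add_comm]

theorem measurable_upwardNormal : Measurable (upwardNormal e γ) :=
  e.symm.continuous.measurable.comp
    ((WithLp.prod_continuous_toLp 2 (E k) ℝ).measurable.comp
      ((measurable_gradient γ).neg.prodMk measurable_const))

theorem areaElement_le {K : ℝ≥0} (hγ : LipschitzWith K γ) (x : E k) : areaElement γ x ≤ 1 + K := by
  have h := norm_fderiv_le_of_lipschitz ℝ hγ (x₀ := x)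
  rw [areaElement, Real.sqrt_le_left (by positivity)]
  nlinarith [norm_nonneg (fderiv ℝ γ x), K.2]

variable {e} {D U : Set (E d)} {K : ℝ≥0}

/-- Points of negative height have a neighbourhood missing `D`; a point of height zero is the limit
of the points vertically above it, which lie in `D`. -/
theorem IsEpigraphOn.mem_frontier_iff (h : IsEpigraphOn e γ D U K) (hD : IsOpen D) {y : E d}
    (hy : y ∈ U) : y ∈ frontier D ↔ height e γ y = 0 := by
  have hcont := (lipschitzWith_height e h.lipschitz).continuous
  rw [hD.frontier_eq, Set.mem_sdiff, h.mem_iff y hy]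
  constructor
  · rintro ⟨h1, h2⟩
    refine le_antisymm (not_lt.1 h2) (not_lt.1 fun hlt => ?_)
    have hopen : IsOpen (U ∩ {z | height e γ z < 0}) :=
      h.isOpen.inter (isOpen_lt hcont continuous_const)
    obtain ⟨z, ⟨hzU, hz0⟩, hzD⟩ := mem_closure_iff.1 h1 _ hopen ⟨hy, hlt⟩
    exact lt_asymm ((h.mem_iff z hzU).1 hzD) hz0
  · intro h0
    refine ⟨?_, by rw [h0]; exact lt_irrefl _⟩
    have hc : Continuous fun s : ℝ => pointAbove e γ (e y).fst s :=
      (continuous_pointAbove e h.lipschitz.continuous).comp (Continuous.prodMk_right _)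
    have hlim : Tendsto (fun s : ℝ => pointAbove e γ (e y).fst s) (𝓝[>] 0) (𝓝 y) := by
      have := (hc.tendsto 0).mono_left (nhdsWithin_le_nhds (s := Ioi 0))
      rwa [← h0, pointAbove_fst_height, h0] at this
    refine mem_closure_of_tendsto hlim ?_
    filter_upwards [hlim (h.isOpen.mem_nhds hy), self_mem_nhdsWithin] with s hs hs0
    rw [h.mem_iff _ hs, height_pointAbove]
    exact hs0

theorem IsEpigraphOn.pointAbove_zero_mem_frontier (h : IsEpigraphOn e γ D U K) (hD : IsOpen D)
    {x : E k} (hx : pointAbove e γ x 0 ∈ U) : pointAbove e γ x 0 ∈ frontier D :=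
  (h.mem_frontier_iff hD hx).2 (height_pointAbove e x 0)

theorem IsEpigraphOn.isOutwardUnitNormal (h : IsEpigraphOn e γ D U K) {x : E k}
    (hx : pointAbove e γ x 0 ∈ U) (hd : DifferentiableAt ℝ γ x) :
    IsOutwardUnitNormal D (pointAbove e γ x 0) (-((areaElement γ x)⁻¹ • upwardNormal e γ x)) := by
  set J := areaElement γ x
  set p := pointAbove e γ x 0
  have hJ : 0 < J := areaElement_pos γ x
  refine ⟨?_, fun ε hε => ?_⟩
  · rw [norm_neg, norm_smul, norm_upwardNormal, norm_inv, Real.norm_of_nonneg hJ.le,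
      inv_mul_cancel₀ hJ.ne']
  have hgrad : HasGradientAt (height e γ) (upwardNormal e γ x) p := by
    have hfst : (e p).fst = x := fst_pointAbove e x 0
    have hdh : DifferentiableAt ℝ (height e γ) p := by
      have h2 : Differentiable ℝ fun y : E d => (e y).snd :=
        (WithLp.sndL 2 ℝ (E k) ℝ).differentiable.comp e.toContinuousLinearEquiv.differentiable
      have h1 : Differentiable ℝ fun y : E d => (e y).fst :=
        (WithLp.fstL 2 ℝ (E k) ℝ).differentiable.comp e.toContinuousLinearEquiv.differentiable
      exact (h2 p).sub (DifferentiableAt.comp (g := γ) p (by rw [hfst]; exact hd) (h1 p))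
    have := hdh.hasGradientAt
    rwa [gradient_height e (by rw [hfst]; exact hd), hfst] at this
  -- In a cone of aperture `ε` the linear part of the height has size at least J ε ‖y - p‖, so an
  -- error of half that size cannot change the sign.
  have ho := (hasGradientAt_iff_isLittleO.1 hgrad).def (c := J * (ε / 2)) (by positivity)
  filter_upwards [nhdsWithin_le_nhds ho, nhdsWithin_le_nhds (h.isOpen.mem_nhds hx),
    self_mem_nhdsWithin] with y hy hyU hne
  have hn : 0 < ‖y - p‖ := norm_pos_iff.2 (sub_ne_zero.2 hne)
  rw [height_pointAbove, sub_zero, Real.norm_eq_abs, abs_le] at hy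
  rw [h.mem_iff y hyU, inner_neg_left, real_inner_smul_left, not_lt]
  have hpos : 0 < J * (ε / 2) * ‖y - p‖ := by positivity
  set q := ⟪upwardNormal e γ x, y - p⟫
  have hq : J * (J⁻¹ * q) = q := by field_simp
  constructor
  · intro hle
    have := mul_le_mul_of_nonneg_left hle hJ.le
    nlinarith [hy.1]
  · intro hle
    have := mul_le_mul_of_nonneg_left hle hJ.le
    nlinarith [hy.2]

theorem IsEpigraphOn.outwardNormal_eq (h : IsEpigraphOn e γ D U K) {x : E k}
    (hx : pointAbove e γ x 0 ∈ U) (hd : DifferentiableAt ℝ γ x) :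
    outwardNormal D (pointAbove e γ x 0) = -((areaElement γ x)⁻¹ • upwardNormal e γ x) := by
  have hν := h.isOutwardUnitNormal hx hd
  have hex : ∃ ν, IsOutwardUnitNormal D (pointAbove e γ x 0) ν := ⟨_, hν⟩
  rw [outwardNormal, dif_pos hex]
  exact hex.choose_spec.unique hν

variable (e) in
theorem measurableEmbedding_pointAbove_zero (hγ : Continuous γ) :
    MeasurableEmbedding fun x => pointAbove e γ x 0 := by
  refine Continuous.measurableEmbedding ?_ fun x y hxy => ?_
  · exact (continuous_pointAbove e hγ).comp (Continuous.prodMk_left _)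
  · rw [← fst_pointAbove e (γ := γ) x 0, ← fst_pointAbove e (γ := γ) y 0]
    exact congrArg (fun z => (e z).fst) hxy

variable (e) in
theorem restrict_range_pointAbove_zero (hγ : LipschitzWith K γ) :
    (μHE[k] : Measure (E d)).restrict (range fun x => pointAbove e γ x 0) =
      (volume.withDensity fun x => ENNReal.ofReal (areaElement γ x)).map
        fun x => pointAbove e γ x 0 := by
  have hemb := measurableEmbedding_pointAbove_zero e hγ.continuous
  ext A hA
  rw [hemb.map_apply, withDensity_apply _ (hemb.measurable hA), Measure.restrict_apply hA,
    ← image_preimage_eq_inter_range, ← euclideanHausdorffMeasure_graphMap_image hγ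
      (hemb.measurable hA)]
  have : (fun x => pointAbove e γ x 0) = e.symm ∘ graphMap γ := funext (pointAbove_zero e)
  rw [this, image_comp, e.symm.isometry.euclideanHausdorffMeasure_image]
  simp

/-- Integration over the boundary in a chart. -/
theorem IsEpigraphOn.integral_frontier (h : IsEpigraphOn e γ D U K) (hD : IsOpen D) {f : E d → ℝ}
    (hf : ∀ y ∉ U, f y = 0) :
    (Integrable f ((μHE[k] : Measure (E d)).restrict (frontier D)) ↔
      Integrable fun x => areaElement γ x * f (pointAbove e γ x 0)) ∧
    ∫ y, f y ∂((μHE[k] : Measure (E d)).restrict (frontier D)) =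
      ∫ x, areaElement γ x * f (pointAbove e γ x 0) := by
  have hemb := measurableEmbedding_pointAbove_zero e h.lipschitz.continuous
  set R := range fun x => pointAbove e γ x 0
  have hset : frontier D ∩ U = R ∩ U := by
    ext y
    refine and_congr_left fun hy => ?_
    rw [h.mem_frontier_iff hD hy]
    constructor
    · intro h0
      exact ⟨(e y).fst, by simp only [← h0, pointAbove_fst_height]⟩
    · rintro ⟨x, rfl⟩
      exact height_pointAbove e x 0
  have hres : ((μHE[k] : Measure (E d)).restrict (frontier D)).restrict U
      = ((μHE[k] : Measure (E d)).restrict R).restrict U := by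
    rw [restrict_restrict h.isOpen.measurableSet, restrict_restrict h.isOpen.measurableSet,
      inter_comm, hset, inter_comm]
  have hsupp : Function.support f ⊆ U := fun y hy => by
    by_contra hyU
    exact hy (hf y hyU)
  have hJ : ∀ x, (ENNReal.ofReal (areaElement γ x)).toReal = areaElement γ x := fun x =>
    ENNReal.toReal_ofReal (areaElement_pos γ x).le
  have hJm := (measurable_areaElement γ).ennreal_ofReal
  constructor
  · rw [← integrableOn_iff_integrable_of_support_subset hsupp, IntegrableOn, hres,
      ← IntegrableOn, integrableOn_iff_integrable_of_support_subset hsupp,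
      restrict_range_pointAbove_zero e h.lipschitz, hemb.integrable_map_iff,
      integrable_withDensity_iff_integrable_smul' hJm (by simp)]
    simp only [hJ, smul_eq_mul, Function.comp_apply]
  · rw [← setIntegral_eq_integral_of_forall_compl_eq_zero hf, hres,
      setIntegral_eq_integral_of_forall_compl_eq_zero hf,
      restrict_range_pointAbove_zero e h.lipschitz, hemb.integral_map,
      integral_withDensity_eq_integral_toReal_smul hJm (by simp)]
    simp only [hJ, smul_eq_mul]

variable (e) in
/-- The volume in the coordinates given by the abscissa and the rescaled height. -/
theorem measurePreserving_pointAbove_mul (hγ : Continuous γ) {ε : ℝ} (hε : 0 < ε) :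
    MeasurePreserving (fun p : E k × ℝ => pointAbove e γ p.1 (ε * p.2))
      (volume.prod volume) (ENNReal.ofReal ε⁻¹ • volume) := by
  have h1 : MeasurePreserving (fun p : E k × ℝ => (p.1, γ p.1 + ε * p.2))
      (volume.prod volume) (volume.prod (ENNReal.ofReal ε⁻¹ • volume)) := by
    -- Over each abscissa the map is a dilation by ε followed by a translation, so no regularity of
    -- `γ` beyond continuity is needed.
    refine (MeasurePreserving.id volume).skew_product (g := fun x s => γ x + ε * s)
      (by fun_prop) (Eventually.of_forall fun x => ?_)
    have : (fun s : ℝ => γ x + ε * s) = (fun s => γ x + s) ∘ (fun s => ε * s) := rfl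
    rw [this, ← Measure.map_map (by fun_prop) (by fun_prop), Real.map_volume_mul_left hε.ne',
      Measure.map_smul, map_add_left_eq_self, abs_of_pos (inv_pos.2 hε)]
  rw [Measure.prod_smul_right] at h1
  have h2 : MeasurePreserving (fun p : E k × ℝ => e.symm (WithLp.toLp 2 p))
      (volume.prod volume) volume :=
    e.symm.measurePreserving.comp (WithLp.volume_preserving_toLp (E k) ℝ)
  exact (h2.smul_measure _).comp h1

variable (e) in
theorem integral_comp_pointAbove_mul (hγ : Continuous γ) {ε : ℝ} (hε : 0 < ε) {f : E d → ℝ}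
    (hf : AEStronglyMeasurable f) :
    ∫ p : E k × ℝ, f (pointAbove e γ p.1 (ε * p.2)) = ε⁻¹ * ∫ y, f y := by
  have hmp := measurePreserving_pointAbove_mul e hγ hε
  have := integral_map (f := f) hmp.measurable.aemeasurable (by
    rw [hmp.map_eq]; exact hf.smul_measure _)
  rw [hmp.map_eq, integral_smul_measure, ENNReal.toReal_ofReal (inv_pos.2 hε).le] at this
  exact this.symm

end Chart

/-! ### The one-dimensional cut-off. -/

section Cutoff

/-- A smooth function equal to `0` on `(-∞, 1]` and to `1` on `[2, ∞)`. -/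
def smoothCutoff (t : ℝ) : ℝ := Real.smoothTransition (t - 1)

theorem contDiff_smoothCutoff : ContDiff ℝ ∞ smoothCutoff :=
  Real.smoothTransition.contDiff.comp (contDiff_id.sub contDiff_const)

theorem smoothCutoff_of_le {t : ℝ} (h : t ≤ 1) : smoothCutoff t = 0 :=
  Real.smoothTransition.zero_of_nonpos (by linarith)

theorem smoothCutoff_of_ge {t : ℝ} (h : 2 ≤ t) : smoothCutoff t = 1 :=
  Real.smoothTransition.one_of_one_le (by linarith)

theorem norm_smoothCutoff_le (t : ℝ) : ‖smoothCutoff t‖ ≤ 1 := by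
  rw [smoothCutoff, Real.norm_of_nonneg (Real.smoothTransition.nonneg _)]
  exact Real.smoothTransition.le_one _

theorem hasDerivAt_smoothCutoff (t : ℝ) : HasDerivAt smoothCutoff (deriv smoothCutoff t) t :=
  (contDiff_smoothCutoff.differentiable (by simp) t).hasDerivAt

theorem continuous_deriv_smoothCutoff : Continuous (deriv smoothCutoff) :=
  contDiff_smoothCutoff.continuous_deriv (by simp)

/-- The rescaled derivative lives at heights between ε and 2ε, hence strictly inside `D`. -/
theorem deriv_smoothCutoff_of_notMem {t : ℝ} (h : t ∉ Icc (1 : ℝ) 2) : deriv smoothCutoff t = 0 := by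
  rw [mem_Icc, not_and_or, not_le, not_le] at h
  rcases h with h | h
  · have : smoothCutoff =ᶠ[𝓝 t] fun _ => 0 := by
      filter_upwards [eventually_lt_nhds h] with s hs using smoothCutoff_of_le hs.le
    rw [this.deriv_eq, deriv_const]
  · have : smoothCutoff =ᶠ[𝓝 t] fun _ => 1 := by
      filter_upwards [eventually_gt_nhds h] with s hs using smoothCutoff_of_ge hs.le
    rw [this.deriv_eq, deriv_const]

theorem hasCompactSupport_deriv_smoothCutoff : HasCompactSupport (deriv smoothCutoff) :=
  HasCompactSupport.of_support_subset_isCompact isCompact_Icc fun t ht => by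
    by_contra h
    exact ht (deriv_smoothCutoff_of_notMem h)

theorem integrable_deriv_smoothCutoff : Integrable (deriv smoothCutoff) :=
  continuous_deriv_smoothCutoff.integrable_of_hasCompactSupport
    hasCompactSupport_deriv_smoothCutoff

/-- Total mass 1 is why the collar averages tend to the surface integral with no extra constant. -/
theorem integral_deriv_smoothCutoff : ∫ t, deriv smoothCutoff t = 1 := by
  rw [integral_of_hasDerivAt_of_tendsto (m := 0) (n := 1) hasDerivAt_smoothCutoff
    integrable_deriv_smoothCutoff, sub_zero]
  · refine tendsto_const_nhds.congr' ?_
    filter_upwards [eventually_le_atBot (1 : ℝ)] with t ht using (smoothCutoff_of_le ht).symm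
  · refine tendsto_const_nhds.congr' ?_
    filter_upwards [eventually_ge_atTop (2 : ℝ)] with t ht using (smoothCutoff_of_ge ht).symm

theorem exists_norm_deriv_smoothCutoff_le : ∃ M, ∀ t, ‖deriv smoothCutoff t‖ ≤ M :=
  hasCompactSupport_deriv_smoothCutoff.exists_bound_of_continuous continuous_deriv_smoothCutoff

theorem exists_lipschitzWith_smoothCutoff : ∃ L, LipschitzWith L smoothCutoff := by
  obtain ⟨M, hM⟩ := exists_norm_deriv_smoothCutoff_le
  refine ⟨M.toNNReal, lipschitzWith_of_nnnorm_deriv_le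
    (contDiff_smoothCutoff.differentiable (by simp)) fun t => ?_⟩
  rw [← NNReal.coe_le_coe, coe_nnnorm]
  exact (hM t).trans (Real.le_coe_toNNReal M)

end Cutoff

/-! ### Functions of class C¹ up to the boundary. -/

section C1UpToBoundary

variable {d : ℕ} {D : Set (E d)} {φ : E d → ℝ}

theorem IsC1UpToBoundary.continuousOn_gradient (hφ : IsC1UpToBoundary D φ) (hD : IsOpen D) :
    ContinuousOn (∇ φ) D := by
  intro x hx
  obtain ⟨g, hg⟩ := hφ.tendsto_gradient x (subset_closure hx)
  -- The filter `𝓝[D] x` contains the point `x` itself, so the limit must be the value there.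
  have : g = ∇ φ x := by
    rw [hD.nhdsWithin_eq hx] at hg
    exact (tendsto_nhds_unique (hg.mono_left (pure_le_nhds x)) (tendsto_pure_nhds (∇ φ) x))
  rwa [this] at hg

theorem IsC1UpToBoundary.continuousOn_closureGradient (hφ : IsC1UpToBoundary D φ) :
    ContinuousOn (closureGradient D φ) (closure D) :=
  continuousOn_extendFrom subset_rfl hφ.tendsto_gradient

theorem IsC1UpToBoundary.closureGradient_eq (hφ : IsC1UpToBoundary D φ) (hD : IsOpen D) {x : E d}
    (hx : x ∈ D) : closureGradient D φ x = ∇ φ x :=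
  extendFrom_extends (hφ.continuousOn_gradient hD) x hx

theorem integrableOn_of_continuousOn_closure {G : Type*} [NormedAddCommGroup G] {f : E d → G}
    (hb : Bornology.IsBounded D) (hf : ContinuousOn f (closure D)) : IntegrableOn f D :=
  (hf.integrableOn_compact hb.isCompact_closure).mono_set subset_closure

theorem continuous_gradient_of_contDiff {η : E d → ℝ} (hη : ContDiff ℝ ∞ η) : Continuous (∇ η) :=
  (InnerProductSpace.toDual ℝ (E d)).symm.continuous.comp (hη.continuous_fderiv (by simp))

theorem integrableOn_localized {F : E d → E d} {η : E d → ℝ} (hD : IsOpen D)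
    (hb : Bornology.IsBounded D) (hF : ContinuousOn F (closure D)) (hφ : IsC1UpToBoundary D φ)
    (hη : ContDiff ℝ ∞ η) :
    IntegrableOn (fun y => η y * ⟪F y, ∇ φ y⟫ + φ y * ⟪F y, ∇ η y⟫) D := by
  have : ContinuousOn (fun y => η y * ⟪F y, closureGradient D φ y⟫ + φ y * ⟪F y, ∇ η y⟫)
      (closure D) :=
    (hη.continuous.continuousOn.mul (hF.inner hφ.continuousOn_closureGradient)).add
      (hφ.continuousOn.mul (hF.inner (continuous_gradient_of_contDiff hη).continuousOn))
  refine (integrableOn_of_continuousOn_closure hb this).congr_fun (fun y hy => ?_) hD.measurableSet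
  simp only [hφ.closureGradient_eq hD hy]

theorem measurable_indicator_of_continuousOn {G : Type*} [NormedAddCommGroup G]
    [MeasurableSpace G] [BorelSpace G] {f : E d → G} {s : Set (E d)} (hs : MeasurableSet s)
    (hf : ContinuousOn f s) : Measurable (s.indicator f) := by
  classical
  rw [← piecewise_eq_indicator]
  exact ContinuousOn.measurable_piecewise hf continuousOn_const hs

end C1UpToBoundary

/-! ### Convergence of the collar integrals. -/

section Local

open Measure Module

variable {d k : ℕ} {e : E d ≃ₗᵢ[ℝ] WithLp 2 (E k × ℝ)} {γ : E k → ℝ} {D U : Set (E d)} {K : ℝ≥0}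

/-- The layer integrals over the collar `ε < height < 2 ε` converge to a surface integral. -/
theorem IsEpigraphOn.tendsto_layer (h : IsEpigraphOn e γ D U K) (hD : IsOpen D) {B : E d → E d}
    {C R : ℝ} (hC : 0 ≤ C) (hB : ContinuousOn B (closure D)) (hBC : ∀ y ∈ closure D, ‖B y‖ ≤ C) {T : Set (E d)}
    (hT : IsClosed T) (hTU : T ⊆ U) (hTR : T ⊆ Metric.closedBall 0 R) (hBT : ∀ y ∉ T, B y = 0) :
    Integrable (fun x => ⟪B (pointAbove e γ x 0), upwardNormal e γ x⟫) ∧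
    Tendsto (fun ε => ε⁻¹ * ∫ y in D, deriv smoothCutoff (ε⁻¹ * height e γ y) *
      ⟪B y, upwardNormal e γ (e y).fst⟫) (𝓝[>] 0)
      (𝓝 (∫ x, ⟪B (pointAbove e γ x 0), upwardNormal e γ x⟫)) := by
  classical
  have hγ := h.lipschitz.continuous
  have hcont : Continuous fun p : E k × ℝ => pointAbove e γ p.1 p.2 := continuous_pointAbove e hγ
  have hN := measurable_upwardNormal (γ := γ) e
  have hNle : ∀ x, ‖upwardNormal e γ x‖ ≤ 1 + K := fun x => by
    rw [norm_upwardNormal]; exact areaElement_le h.lipschitz x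
  have hheight : Continuous (height e γ) := (lipschitzWith_height e h.lipschitz).continuous
  -- `B` is continuous only on `closure D`; indicators provide measurable representatives.
  have hAm : Measurable (D.indicator B) :=
    measurable_indicator_of_continuousOn hD.measurableSet (hB.mono subset_closure)
  have hAcm : Measurable ((closure D).indicator B) :=
    measurable_indicator_of_continuousOn isClosed_closure.measurableSet hB
  have hball : ∀ x s, pointAbove e γ x s ∈ T → x ∈ Metric.closedBall (0 : E k) R := fun x s hx => by
    have := hTR hx
    rw [mem_closedBall_zero_iff] at this ⊢
    exact (norm_le_norm_pointAbove e x s).trans this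
  have hindball : Integrable ((Metric.closedBall (0 : E k) R).indicator fun _ => C * (1 + (K : ℝ))) := by
    rw [integrable_indicator_iff Metric.isClosed_closedBall.measurableSet]
    exact integrableOn_const (isCompact_closedBall _ _).measure_lt_top.ne
  have hBnd : ∀ x s, (pointAbove e γ x s ∈ T → pointAbove e γ x s ∈ closure D) →
      ‖⟪B (pointAbove e γ x s), upwardNormal e γ x⟫‖
        ≤ (Metric.closedBall (0 : E k) R).indicator (fun _ => C * (1 + (K : ℝ))) x := by
    intro x s hcl
    by_cases hxT : pointAbove e γ x s ∈ T
    · rw [indicator_of_mem (hball x s hxT)]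
      have h1 := hBC _ (hcl hxT)
      exact (norm_inner_le_norm _ _).trans
        (mul_le_mul h1 (hNle x) (norm_nonneg _) ((norm_nonneg _).trans h1))
    · rw [hBT _ hxT, inner_zero_left, norm_zero]
      by_cases hx : x ∈ Metric.closedBall (0 : E k) R
      · rw [indicator_of_mem hx]
        positivity
      · rw [indicator_of_notMem hx]
  have hfront : ∀ x, pointAbove e γ x 0 ∈ T → pointAbove e γ x 0 ∈ closure D := fun x hx =>
    frontier_subset_closure (h.pointAbove_zero_mem_frontier hD (hTU hx))
  have hBint : Integrable (fun x => ⟪B (pointAbove e γ x 0), upwardNormal e γ x⟫) := by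
    refine Integrable.mono' hindball ?_ (Eventually.of_forall fun x => hBnd x 0 (hfront x))
    have : (fun x => ⟪B (pointAbove e γ x 0), upwardNormal e γ x⟫)
        = fun x => ⟪(closure D).indicator B (pointAbove e γ x 0), upwardNormal e γ x⟫ := by
      ext x
      by_cases hx : pointAbove e γ x 0 ∈ T
      · rw [indicator_of_mem (hfront x hx)]
      · rw [indicator_apply, hBT _ hx, ite_self]
    rw [this]
    exact ((hAcm.comp (hcont.comp (Continuous.prodMk_left 0)).measurable).inner
      hN).aestronglyMeasurable
  refine ⟨hBint, ?_⟩
  -- Substituting y = `pointAbove e γ x (ε * s)` absorbs the factor ε⁻¹ and fixes the domain of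
  -- integration as ε varies.
  have hchange : ∀ ε : ℝ, 0 < ε → ∫ p : E k × ℝ, deriv smoothCutoff p.2 *
        ⟪D.indicator B (pointAbove e γ p.1 (ε * p.2)), upwardNormal e γ p.1⟫
      = ε⁻¹ * ∫ y in D, deriv smoothCutoff (ε⁻¹ * height e γ y) *
        ⟪B y, upwardNormal e γ (e y).fst⟫ := by
    intro ε hε
    have := integral_comp_pointAbove_mul e hγ hε (f := fun y =>
      deriv smoothCutoff (ε⁻¹ * height e γ y) * ⟪D.indicator B y, upwardNormal e γ (e y).fst⟫) ?_
    · simp only [height_pointAbove, fst_pointAbove, inv_mul_cancel_left₀ hε.ne'] at this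
      rw [this, ← integral_indicator hD.measurableSet]
      congr 1
      refine integral_congr_ae (Eventually.of_forall fun y => ?_)
      by_cases hy : y ∈ D <;> simp [hy]
    · exact ((continuous_deriv_smoothCutoff.comp (continuous_const.mul hheight)).measurable.mul
        (hAm.inner (hN.comp (continuous_fst_coord e).measurable))).aestronglyMeasurable
  have hlimval : ∫ p : E k × ℝ, deriv smoothCutoff p.2 *
        ⟪B (pointAbove e γ p.1 0), upwardNormal e γ p.1⟫
      = ∫ x, ⟪B (pointAbove e γ x 0), upwardNormal e γ x⟫ := by
    have := integral_prod_mul (μ := (volume : Measure (E k))) (ν := (volume : Measure ℝ))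
      (fun x => ⟪B (pointAbove e γ x 0), upwardNormal e γ x⟫) (deriv smoothCutoff)
    rw [integral_deriv_smoothCutoff, mul_one] at this
    rw [← this]
    refine integral_congr_ae (Eventually.of_forall fun p => mul_comm _ _)
  rw [← hlimval]
  refine Tendsto.congr' (f₁ := fun ε => ∫ p : E k × ℝ, deriv smoothCutoff p.2 *
        ⟪D.indicator B (pointAbove e γ p.1 (ε * p.2)), upwardNormal e γ p.1⟫) ?_ ?_
  · filter_upwards [self_mem_nhdsWithin] with ε hε using hchange ε hε
  refine tendsto_integral_filter_of_dominated_convergence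
    (fun p : E k × ℝ => (Metric.closedBall (0 : E k) R).indicator (fun _ => C * (1 + (K : ℝ))) p.1 *
      ‖deriv smoothCutoff p.2‖) ?_ ?_ (hindball.mul_prod integrable_deriv_smoothCutoff.norm) ?_
  · refine Eventually.of_forall fun ε => Measurable.aestronglyMeasurable ?_
    refine (continuous_deriv_smoothCutoff.measurable.comp measurable_snd).mul
      (Measurable.inner (hAm.comp ?_) (hN.comp measurable_fst))
    exact (hcont.comp (continuous_fst.prodMk (continuous_const.mul continuous_snd))).measurable
  · refine Eventually.of_forall fun ε => Eventually.of_forall fun p => ?_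
    rw [norm_mul, mul_comm]
    gcongr
    by_cases hp : pointAbove e γ p.1 (ε * p.2) ∈ D
    · rw [indicator_of_mem hp]
      exact hBnd _ _ fun _ => subset_closure hp
    · rw [indicator_of_notMem hp, inner_zero_left, norm_zero]
      exact indicator_nonneg (fun _ _ => by positivity) _
  · refine Eventually.of_forall fun p => ?_
    -- Only s > 0 matters, so the points approach the graph from inside `D`, where continuity of `B`
    -- up to the boundary applies.
    by_cases hs : p.2 ∈ Icc (1 : ℝ) 2
    swap
    · simp only [deriv_smoothCutoff_of_notMem hs, zero_mul]
      exact tendsto_const_nhds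
    refine Tendsto.const_mul _ (Tendsto.inner ?_ tendsto_const_nhds)
    have hs0 : 0 < p.2 := lt_of_lt_of_le one_pos hs.1
    have hpt : Tendsto (fun ε : ℝ => pointAbove e γ p.1 (ε * p.2)) (𝓝[>] 0)
        (𝓝 (pointAbove e γ p.1 0)) := by
      have hc : Continuous fun ε : ℝ => pointAbove e γ p.1 (ε * p.2) :=
        hcont.comp (continuous_const.prodMk (continuous_id.mul continuous_const))
      have := (hc.tendsto 0).mono_left (nhdsWithin_le_nhds (s := Ioi 0))
      rwa [zero_mul] at this
    by_cases hT0 : pointAbove e γ p.1 0 ∈ T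
    · have hev : ∀ᶠ ε in 𝓝[>] (0 : ℝ), pointAbove e γ p.1 (ε * p.2) ∈ D := by
        filter_upwards [hpt (h.isOpen.mem_nhds (hTU hT0)), self_mem_nhdsWithin] with ε hε hε0
        rw [h.mem_iff _ hε, height_pointAbove]
        exact mul_pos hε0 hs0
      refine Tendsto.congr' (f₁ := fun ε => B (pointAbove e γ p.1 (ε * p.2))) ?_ ?_
      · filter_upwards [hev] with ε hε using (indicator_of_mem hε B).symm
      · refine (hB _ (hfront _ hT0)).tendsto.comp (tendsto_nhdsWithin_iff.2 ⟨hpt, ?_⟩)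
        filter_upwards [hev] with ε hε using subset_closure hε
    · rw [hBT _ hT0]
      refine tendsto_const_nhds.congr' ?_
      filter_upwards [hpt (hT.isOpen_compl.mem_nhds hT0)] with ε hε
      rw [indicator_apply, hBT _ hε, ite_self]

end Local

/-! ### Green's formula in one chart. -/

section Local

open Measure Module

variable {d k : ℕ} {e : E d ≃ₗᵢ[ℝ] WithLp 2 (E k × ℝ)} {γ : E k → ℝ} {D U : Set (E d)} {K : ℝ≥0}

theorem gradient_smoothCutoff_comp {f : E d → ℝ} {a : ℝ} {y : E d} (hf : DifferentiableAt ℝ f y) :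
    DifferentiableAt ℝ (fun z => smoothCutoff (a * f z)) y ∧
    ∇ (fun z => smoothCutoff (a * f z)) y = (a * deriv smoothCutoff (a * f y)) • ∇ f y := by
  have h := (hasDerivAt_smoothCutoff (a * f y)).comp_hasFDerivAt y (hf.hasFDerivAt.const_mul a)
  refine ⟨h.differentiableAt, HasGradientAt.gradient (hasGradientAt_iff_hasFDerivAt.2 ?_)⟩
  refine h.congr_fderiv ?_
  rw [map_smul, smul_smul, mul_comm]
  congr 1
  exact (hf.hasGradientAt.hasFDerivAt.unique hf.hasFDerivAt).symm

/-- Testing with a cut-off that vanishes below height `ε`. -/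
theorem IsEpigraphOn.integral_cutoff (h : IsEpigraphOn e γ D U K) (hD : IsOpen D)
    (hb : Bornology.IsBounded D) {F : E d → E d} {φ η : E d → ℝ}
    (hF : ContinuousOn F (closure D)) (hdiv : WeaklyDivFree D F) (hφ : IsC1UpToBoundary D φ)
    (hη : ContDiff ℝ ∞ η) (hηc : HasCompactSupport η) (hηU : tsupport η ⊆ U) {ε : ℝ} (hε : 0 < ε) :
    (∫ y in D, smoothCutoff (ε⁻¹ * height e γ y) *
        (η y * ⟪F y, ∇ φ y⟫ + φ y * ⟪F y, ∇ η y⟫)) +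
      ε⁻¹ * ∫ y in D, deriv smoothCutoff (ε⁻¹ * height e γ y) *
        ⟪(φ y * η y) • F y, upwardNormal e γ (e y).fst⟫ = 0 := by
  have hhl := lipschitzWith_height e h.lipschitz
  obtain ⟨L, hL⟩ := exists_lipschitzWith_smoothCutoff
  obtain ⟨Lη, hLη⟩ := hη.lipschitzWith_of_hasCompactSupport hηc (by simp)
  set χ : E d → ℝ := fun y => smoothCutoff (ε⁻¹ * height e γ y) with hχ
  have hχl : LipschitzWith (L * (‖ε⁻¹‖₊ * (1 + K))) χ :=
    hL.comp ((lipschitzWith_smul ε⁻¹).comp hhl)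
  set c : E d → ℝ := fun y => η y * χ y with hc
  have hcc : HasCompactSupport c := hηc.mul_right
  -- The cut-off vanishes below height ε, which keeps the closed support off the boundary.
  have hcs : tsupport c ⊆ D := by
    have hclosed : IsClosed (tsupport η ∩ {y | ε ≤ height e γ y}) :=
      (isClosed_tsupport η).inter (isClosed_le continuous_const hhl.continuous)
    have hsub : Function.support c ⊆ tsupport η ∩ {y | ε ≤ height e γ y} := fun y hy => by
      refine ⟨subset_tsupport _ (left_ne_zero_of_mul hy), (not_lt.1 fun hlt => ?_ : ε ≤ height e γ y)⟩
      refine right_ne_zero_of_mul hy (smoothCutoff_of_le ?_)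
      rw [inv_mul_eq_div, div_le_one hε]
      exact hlt.le
    refine (closure_minimal hsub hclosed).trans fun y hy => ?_
    exact (h.mem_iff y (hηU hy.1)).2 (hε.trans_le hy.2)
  obtain ⟨Lc, hLc⟩ := exists_lipschitzWith_of_hasCompactSupport (fun y =>
    exists_lipschitzOnWith_mul_nhds univ_mem univ_mem hLη.lipschitzOnWith hχl.lipschitzOnWith) hcc
  have hzero := hdiv.integral_cutoff hD (integrableOn_of_continuousOn_closure hb hF)
    hφ.differentiableAt (hφ.continuousOn_gradient hD) hLc hcc hcs
  rw [← integral_const_mul, ← integral_add, ← hzero]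
  · refine setIntegral_congr_ae hD.measurableSet ?_
    filter_upwards [hhl.ae_differentiableAt (μ := volume)] with y hdy hy
    have hχd := gradient_smoothCutoff_comp (a := ε⁻¹) hdy
    have hgrad : ∇ c y = η y • ((ε⁻¹ * deriv smoothCutoff (ε⁻¹ * height e γ y)) •
        upwardNormal e γ (e y).fst) + χ y • ∇ η y := by
      rw [hc, gradient_mul_of_differentiableAt (hη.differentiable (by simp) y) hχd.1, hχd.2,
        gradient_height e (differentiableAt_of_height e hdy)]
    rw [hgrad]
    simp only [inner_add_right, inner_smul_right, real_inner_smul_left, hχ]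
    ring
  · refine (integrableOn_localized hD hb hF hφ hη).bdd_mul (c := 1)
      hχl.continuous.aestronglyMeasurable (Eventually.of_forall fun y => norm_smoothCutoff_le _)
  · refine Integrable.const_mul ?_ _
    obtain ⟨M, hM⟩ := exists_norm_deriv_smoothCutoff_le
    refine Integrable.bdd_mul (c := M) ?_ (continuous_deriv_smoothCutoff.comp
      (continuous_const.mul hhl.continuous)).aestronglyMeasurable (Eventually.of_forall fun y => hM _)
    have hBc : ContinuousOn (fun y => (φ y * η y) • F y) (closure D) :=
      (hφ.continuousOn.mul hη.continuous.continuousOn).smul hF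
    have hBint := integrableOn_of_continuousOn_closure hb hBc
    refine Integrable.mono' (hBint.norm.mul_const (1 + K))
      (hBint.aestronglyMeasurable.inner ((measurable_upwardNormal e).comp
        (continuous_fst_coord e).measurable).aestronglyMeasurable)
      (Eventually.of_forall fun y => (norm_inner_le_norm _ _).trans ?_)
    rw [norm_upwardNormal]
    exact mul_le_mul_of_nonneg_left (areaElement_le h.lipschitz _) (norm_nonneg _)

/-- Green's formula for a weakly divergence free field, localised to a boundary chart. -/
theorem IsEpigraphOn.integral_localized (h : IsEpigraphOn e γ D U K) (hD : IsOpen D)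
    (hb : Bornology.IsBounded D) {F : E d → E d} {φ η : E d → ℝ}
    (hF : ContinuousOn F (closure D)) (hdiv : WeaklyDivFree D F) (hφ : IsC1UpToBoundary D φ)
    (hη : ContDiff ℝ ∞ η) (hηc : HasCompactSupport η) (hηU : tsupport η ⊆ U) :
    Integrable (fun y => η y * (⟪F y, outwardNormal D y⟫ * φ y))
        ((μHE[k] : Measure (E d)).restrict (frontier D)) ∧
      ∫ y in D, (η y * ⟪F y, ∇ φ y⟫ + φ y * ⟪F y, ∇ η y⟫) =
        ∫ y, η y * (⟪F y, outwardNormal D y⟫ * φ y)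
          ∂((μHE[k] : Measure (E d)).restrict (frontier D)) := by
  have hhl := lipschitzWith_height e h.lipschitz
  have hBc : ContinuousOn (fun y => (φ y * η y) • F y) (closure D) :=
    (hφ.continuousOn.mul hη.continuous.continuousOn).smul hF
  obtain ⟨C, hC⟩ := hb.isCompact_closure.exists_bound_of_continuousOn hBc
  obtain ⟨R, hR⟩ := hηc.isCompact.isBounded.subset_closedBall (0 : E d)
  have hη0 : ∀ y ∉ tsupport η, η y = 0 := fun y hy => image_eq_zero_of_notMem_tsupport hy
  obtain ⟨hint, hlim⟩ := h.tendsto_layer hD (C := max C 0) (le_max_right _ _) hBc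
    (fun y hy => (hC y hy).trans (le_max_left _ _)) (isClosed_tsupport η) hηU hR
    (fun y hy => by simp [hη0 y hy])
  have hfU : ∀ y ∉ U, η y * (⟪F y, outwardNormal D y⟫ * φ y) = 0 := fun y hy => by
    rw [hη0 y fun hy' => hy (hηU hy'), zero_mul]
  obtain ⟨hi, hs⟩ := h.integral_frontier hD hfU
  -- The area element cancels the normalisation of the normal; the sign appears because
  -- `upwardNormal` points into `D`.
  have hae : (fun x => areaElement γ x * (η (pointAbove e γ x 0) *
      (⟪F (pointAbove e γ x 0), outwardNormal D (pointAbove e γ x 0)⟫ * φ (pointAbove e γ x 0))))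
      =ᵐ[volume] fun x => -⟪(φ (pointAbove e γ x 0) * η (pointAbove e γ x 0)) •
        F (pointAbove e γ x 0), upwardNormal e γ x⟫ := by
    filter_upwards [h.lipschitz.ae_differentiableAt (μ := volume)] with x hx
    by_cases hxU : pointAbove e γ x 0 ∈ tsupport η
    · rw [h.outwardNormal_eq (hηU hxU) hx, inner_neg_right, inner_smul_right, real_inner_smul_left]
      have := (areaElement_pos γ x).ne'
      field_simp
    · simp [hη0 _ hxU]
  refine ⟨hi.2 (hint.neg.congr hae.symm), ?_⟩
  rw [hs, integral_congr_ae hae, integral_neg]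
  have hG := integrableOn_localized hD hb hF hφ hη
  -- At a fixed point of positive height the cut-off equals 1 as soon as 2ε is below that height.
  have hlim2 : Tendsto (fun ε => ∫ y in D, smoothCutoff (ε⁻¹ * height e γ y) *
      (η y * ⟪F y, ∇ φ y⟫ + φ y * ⟪F y, ∇ η y⟫)) (𝓝[>] 0)
      (𝓝 (∫ y in D, (η y * ⟪F y, ∇ φ y⟫ + φ y * ⟪F y, ∇ η y⟫))) := by
    refine tendsto_integral_filter_of_dominated_convergence _ (Eventually.of_forall fun ε =>
      (contDiff_smoothCutoff.continuous.comp
        (continuous_const.mul hhl.continuous)).aestronglyMeasurable.mul hG.aestronglyMeasurable)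
      (Eventually.of_forall fun ε => Eventually.of_forall fun y => ?_) hG.norm ?_
    · rw [norm_mul]
      exact mul_le_of_le_one_left (norm_nonneg _) (norm_smoothCutoff_le _)
    · filter_upwards [ae_restrict_mem hD.measurableSet] with y hy
      by_cases hyη : y ∈ tsupport η
      · have hpos := (h.mem_iff y (hηU hyη)).1 hy
        refine tendsto_const_nhds.congr' ?_
        have hev : ∀ᶠ ε in 𝓝[>] (0 : ℝ), ε < height e γ y / 2 :=
          nhdsWithin_le_nhds (eventually_lt_nhds (half_pos hpos))
        filter_upwards [hev, self_mem_nhdsWithin] with ε hε hε0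
        have hε0 : 0 < ε := hε0
        rw [smoothCutoff_of_ge, one_mul]
        rw [inv_mul_eq_div, le_div_iff₀ hε0]
        linarith
      · have h1 : ∇ η y = 0 := by
          rw [gradient, fderiv_of_notMem_tsupport ℝ hyη, map_zero]
        simp [h1, hη0 y hyη]
  have hsum := hlim2.add hlim
  have h0 : Tendsto (fun _ : ℝ => (0 : ℝ)) (𝓝[>] 0) (𝓝 0) := tendsto_const_nhds
  have := tendsto_nhds_unique (hsum.congr' ?_) h0
  · linarith
  · filter_upwards [self_mem_nhdsWithin] with ε hε
    exact h.integral_cutoff hD hb hF hdiv hφ hη hηc hηU hε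

end Local

/-! ### Globalisation of Green's formula. -/

section Green

open scoped Manifold

variable {d : ℕ} {D : Set (E d)} {F : E d → E d} {φ : E d → ℝ}

/-- Green's formula localised to `D` itself, where the boundary term vanishes. -/
theorem integral_localized_interior (hD : IsOpen D) (hb : Bornology.IsBounded D)
    (hF : ContinuousOn F (closure D)) (hdiv : WeaklyDivFree D F) (hφ : IsC1UpToBoundary D φ)
    {η : E d → ℝ} (hη : ContDiff ℝ ∞ η) (hηc : HasCompactSupport η) (hηD : tsupport η ⊆ D) :
    Integrable (fun y => η y * (⟪F y, outwardNormal D y⟫ * φ y)) (surfaceMeasure D) ∧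
      ∫ y in D, (η y * ⟪F y, ∇ φ y⟫ + φ y * ⟪F y, ∇ η y⟫) =
        ∫ y, η y * (⟪F y, outwardNormal D y⟫ * φ y) ∂(surfaceMeasure D) := by
  obtain ⟨L, hL⟩ := hη.lipschitzWith_of_hasCompactSupport hηc (by simp)
  have hae : (fun y => η y * (⟪F y, outwardNormal D y⟫ * φ y)) =ᵐ[surfaceMeasure D] 0 := by
    filter_upwards [ae_restrict_mem isClosed_frontier.measurableSet] with y hy
    rw [hD.frontier_eq] at hy
    have : η y = 0 := image_eq_zero_of_notMem_tsupport fun h => hy.2 (hηD h)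
    simp [this]
  refine ⟨(integrable_zero _ _ _).congr hae.symm, ?_⟩
  rw [integral_congr_ae hae, hdiv.integral_cutoff hD (integrableOn_of_continuousOn_closure hb hF)
    hφ.differentiableAt (hφ.continuousOn_gradient hD) hL hηc hηD]
  simp

/-- Interior and boundary points are put in one form, so that a single compactness argument covers
`closure D`. -/
theorem exists_open_localized (hD : IsOpen D) (hb : Bornology.IsBounded D)
    (hlip : HasLipschitzBoundary D) (hF : ContinuousOn F (closure D)) (hdiv : WeaklyDivFree D F)
    (hφ : IsC1UpToBoundary D φ) {p : E d} (hp : p ∈ closure D) :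
    ∃ U, IsOpen U ∧ p ∈ U ∧ ∀ η : E d → ℝ, ContDiff ℝ ∞ η → HasCompactSupport η → tsupport η ⊆ U →
      Integrable (fun y => η y * (⟪F y, outwardNormal D y⟫ * φ y)) (surfaceMeasure D) ∧
      ∫ y in D, (η y * ⟪F y, ∇ φ y⟫ + φ y * ⟪F y, ∇ η y⟫) =
        ∫ y, η y * (⟪F y, outwardNormal D y⟫ * φ y) ∂(surfaceMeasure D) := by
  by_cases hpD : p ∈ D
  · exact ⟨D, hD, hpD, fun η h1 h2 h3 => integral_localized_interior hD hb hF hdiv hφ h1 h2 h3⟩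
  · have hfr : p ∈ frontier D := by
      rw [hD.frontier_eq]
      exact ⟨hp, hpD⟩
    obtain ⟨e, γ, K, hγ, U, hU, hmem⟩ := hlip p hfr
    have hchart : IsEpigraphOn e γ D (interior U) K :=
      ⟨hγ, isOpen_interior, fun y hy => by
        rw [hmem y (interior_subset hy), height, sub_pos]⟩
    exact ⟨interior U, isOpen_interior, mem_interior_iff_mem_nhds.2 hU, fun η h1 h2 h3 =>
      hchart.integral_localized hD hb hF hdiv hφ h1 h2 h3⟩

/-- **Green's formula** for a continuous, weakly divergence free field on a bounded Lipschitz
domain. -/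
theorem WeaklyDivFree.integral_inner_gradient (hdiv : WeaklyDivFree D F) (hD : IsOpen D)
    (hb : Bornology.IsBounded D) (hlip : HasLipschitzBoundary D) (hF : ContinuousOn F (closure D))
    (hφ : IsC1UpToBoundary D φ) :
    Integrable (fun y => ⟪F y, outwardNormal D y⟫ * φ y) (surfaceMeasure D) ∧
      ∫ y in D, ⟪F y, ∇ φ y⟫ = ∫ y, ⟪F y, outwardNormal D y⟫ * φ y ∂(surfaceMeasure D) := by
  choose U hUo hpU hU using fun p : closure D => exists_open_localized hD hb hlip hF hdiv hφ p.2
  obtain ⟨t, ht⟩ := hb.isCompact_closure.elim_finite_subcover U hUo fun p hp =>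
    mem_iUnion_of_mem ⟨p, hp⟩ (hpU ⟨p, hp⟩)
  obtain ⟨R, hR⟩ := hb.isCompact_closure.isBounded.subset_ball (0 : E d)
  obtain ⟨f, hf⟩ := SmoothPartitionOfUnity.exists_isSubordinate 𝓘(ℝ, E d) isClosed_closure
    -- Intersecting with a ball makes the supports of the partition functions compact.
    (fun i : t => U i ∩ Metric.ball 0 R) (fun i => (hUo i).inter Metric.isOpen_ball) fun p hp => by
      obtain ⟨i, hi, hpi⟩ := mem_iUnion₂.1 (ht hp)
      exact mem_iUnion_of_mem ⟨i, hi⟩ ⟨hpi, hR hp⟩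
  have hs : ∀ i, ContDiff ℝ ∞ (f i) := fun i => (f i).contMDiff.contDiff
  have hc : ∀ i, HasCompactSupport (f i) := fun i =>
    Metric.isCompact_of_isClosed_isBounded (isClosed_tsupport _)
      (Metric.isBounded_ball.subset ((hf i).trans inter_subset_right))
  have hloc := fun i : t => hU i (f i) (hs i) (hc i) ((hf i).trans inter_subset_left)
  have hsum : ∀ y ∈ closure D, ∑ i, f i y = 1 := fun y hy => by
    rw [← finsum_eq_sum_of_fintype]
    exact f.sum_eq_one hy
  -- This makes the terms φ⟨F, ∇η⟩ of the localised formulas cancel in the sum.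
  have hgrad : ∀ y ∈ D, ∑ i, ∇ (f i) y = 0 := fun y hy => by
    have h1 : (fun z => ∑ i, f i z) =ᶠ[𝓝 y] fun _ => 1 := by
      filter_upwards [hD.mem_nhds hy] with z hz using hsum z (subset_closure hz)
    have h2 := h1.fderiv_eq (𝕜 := ℝ)
    rw [fderiv_fun_sum fun i _ => (hs i).differentiable (by simp) y, fderiv_const_apply] at h2
    simp only [gradient]
    rw [← map_sum, h2, map_zero]
  have hbd : (fun y => ∑ i, f i y * (⟪F y, outwardNormal D y⟫ * φ y)) =ᵐ[surfaceMeasure D]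
      fun y => ⟪F y, outwardNormal D y⟫ * φ y := by
    filter_upwards [ae_restrict_mem isClosed_frontier.measurableSet] with y hy
    rw [← Finset.sum_mul, hsum y (frontier_subset_closure hy), one_mul]
  refine ⟨(integrable_finsetSum _ fun i _ => (hloc i).1).congr hbd, ?_⟩
  rw [← integral_congr_ae hbd, integral_finsetSum _ fun i _ => (hloc i).1,
    ← Finset.sum_congr rfl fun i _ => (hloc i).2,
    ← integral_finsetSum _ fun i _ => integrableOn_localized hD hb hF hφ (hs i)]
  refine setIntegral_congr_fun hD.measurableSet fun y hy => ?_
  simp only [Finset.sum_add_distrib]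
  rw [← Finset.sum_mul, hsum y (subset_closure hy), one_mul, ← Finset.mul_sum, ← inner_sum,
    hgrad y hy, inner_zero_right, mul_zero, add_zero]

end Green

/-! ### The scheme and the pointwise energy balance. -/

section Scheme

variable {d : ℕ} {D : Set (E d)}

/-- The magnetic force does no work. -/
theorem inner_magCross_self (hd : d = 2 ∨ d = 3) (v : E d) (B : E (magDim d)) :
    ⟪magCross d v B, v⟫ = 0 := by
  rcases hd with rfl | rfl
  · simp [magCross, PiLp.inner_apply, Fin.sum_univ_two]
    ring
  · simp [magCross, PiLp.inner_apply, Fin.sum_univ_three, crossProduct]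
    ring

theorem memLp_two_of_continuousOn_closure {f : E d → E d} (hD : IsOpen D)
    (hb : Bornology.IsBounded D) (hf : ContinuousOn f (closure D)) :
    MemLp f 2 (volume.restrict D) := by
  obtain ⟨C, hC⟩ := hb.isCompact_closure.exists_bound_of_continuousOn hf
  have : IsFiniteMeasure (volume.restrict D) :=
    ⟨by rw [Measure.restrict_apply_univ]; exact hb.measure_lt_top⟩
  refine MemLp.of_bound ((hf.mono subset_closure).aestronglyMeasurable hD.measurableSet) C ?_
  filter_upwards [ae_restrict_mem hD.measurableSet] with y hy using hC y (subset_closure hy)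

theorem integrableOn_energyDensity {α : ℝ} {ρ : E d → ℝ} {v g : E d → E d} (hD : IsOpen D)
    (hb : Bornology.IsBounded D) (hρ : ContinuousOn ρ (closure D))
    (hv : MemLp v 2 (volume.restrict D)) (hg : MemLp g 2 (volume.restrict D)) :
    IntegrableOn (energyDensity α ρ v g) D := by
  obtain ⟨C, hC⟩ := hb.isCompact_closure.exists_bound_of_continuousOn
    (continuousOn_const (c := α) |>.mul hρ)
  refine Integrable.add ?_ ((memLp_two_iff_integrable_sq_norm hg.1).1 hg)
  refine ((memLp_two_iff_integrable_sq_norm hv.1).1 hv).bdd_mul (c := C)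
    (((continuousOn_const.mul hρ).mono subset_closure).aestronglyMeasurable hD.measurableSet) ?_
  filter_upwards [ae_restrict_mem hD.measurableSet] with y hy using hC y (subset_closure hy)

/-- The field `(1/α) (∇ φθ - ∇ φn) / (θ τ) - ρ vθ` on the closure of `D`. -/
def fluxField (D : Set (E d)) (α τ θ : ℝ) (ρ : E d → ℝ) (vθ : E d → E d) (φn φθ : E d → ℝ)
    (x : E d) : E d :=
  (1 / α) • (1 / (θ * τ)) • (closureGradient D φθ x - closureGradient D φn x) - ρ x • vθ x

theorem continuousOn_fluxField {α τ θ : ℝ} {ρ : E d → ℝ} {vθ : E d → E d} {φn φθ : E d → ℝ}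
    (hρ : ContinuousOn ρ (closure D)) (hvθ : ContinuousOn vθ (closure D))
    (hφn : IsC1UpToBoundary D φn) (hφθ : IsC1UpToBoundary D φθ) :
    ContinuousOn (fluxField D α τ θ ρ vθ φn φθ) (closure D) := by
  have h1 : ContinuousOn (fun x => closureGradient D φθ x - closureGradient D φn x) (closure D) :=
    hφθ.continuousOn_closureGradient.sub hφn.continuousOn_closureGradient
  have h2 : ContinuousOn (fun x => ρ x • vθ x) (closure D) := hρ.smul hvθ
  have h3 : ContinuousOn (fun x => (1 / α) • (1 / (θ * τ)) •
      (closureGradient D φθ x - closureGradient D φn x)) (closure D) :=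
    (continuous_const_smul (1 / α)).comp_continuousOn
      ((continuous_const_smul (1 / (θ * τ))).comp_continuousOn h1)
  exact h3.sub h2

variable {α τ θ : ℝ} {Ω : E d → E (magDim d)} {ρ : E d → ℝ} {vn vθ v1 : E d → E d}
  {φn φθ φ1 : E d → ℝ}

/-- This is the potential equation divided by αθτ. -/
theorem IsThetaStep.weaklyDivFree_fluxField
    (hstep : IsThetaStep D α τ θ Ω ρ vn vθ v1 φn φθ φ1) (hD : IsOpen D)
    (hb : Bornology.IsBounded D) (hα : 0 < α) (hτ : 0 < τ) (hθ : 0 < θ)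
    (hρ : ContinuousOn ρ (closure D)) (hvθ : ContinuousOn vθ (closure D))
    (hφn : IsC1UpToBoundary D φn) (hφθ : IsC1UpToBoundary D φθ) :
    WeaklyDivFree D (fluxField D α τ θ ρ vθ φn φθ) := by
  intro ψ hψ hψc hψD
  have hψ' := (continuous_gradient_of_contDiff hψ).continuousOn (s := closure D)
  have hint : ∀ f : E d → E d, ContinuousOn f (closure D) →
      IntegrableOn (fun x => ⟪f x, ∇ ψ x⟫) D := fun f hf =>
    integrableOn_of_continuousOn_closure hb (hf.inner hψ')
  have i1 := hint _ hφθ.continuousOn_closureGradient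
  have i2 := hint _ hφn.continuousOn_closureGradient
  have i3 : IntegrableOn (fun x => ρ x * ⟪vθ x, ∇ ψ x⟫) D :=
    (hint (fun x => ρ x • vθ x) (hρ.smul hvθ)).congr_fun
      (fun x _ => real_inner_smul_left _ _ _) hD.measurableSet
  have i12 : IntegrableOn (fun x => 1 / α * (1 / (θ * τ) *
      (⟪closureGradient D φθ x, ∇ ψ x⟫ - ⟪closureGradient D φn x, ∇ ψ x⟫))) D :=
    ((i1.sub i2).const_mul _).const_mul _
  have hpot := hstep.potential ψ hψ hψc hψD
  have e1 : ∫ x in D, ⟪∇ φθ x, ∇ ψ x⟫ = ∫ x in D, ⟪closureGradient D φθ x, ∇ ψ x⟫ :=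
    setIntegral_congr_fun hD.measurableSet fun x hx => by
      simp only [hφθ.closureGradient_eq hD hx]
  have e2 : ∫ x in D, ⟪∇ φn x, ∇ ψ x⟫ = ∫ x in D, ⟪closureGradient D φn x, ∇ ψ x⟫ :=
    setIntegral_congr_fun hD.measurableSet fun x hx => by
      simp only [hφn.closureGradient_eq hD hx]
  rw [e1, e2] at hpot
  simp only [fluxField, inner_sub_left, real_inner_smul_left] at hpot ⊢
  rw [integral_sub i12 i3, integral_const_mul,
    integral_const_mul, integral_sub i1 i2, hpot]
  field_simp
  ring

theorem IsThetaStep.gradient_extrapolation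
    (hstep : IsThetaStep D α τ θ Ω ρ vn vθ v1 φn φθ φ1) (hD : IsOpen D)
    (hφn : IsC1UpToBoundary D φn) (hφθ : IsC1UpToBoundary D φθ) {x : E d} (hx : x ∈ D) :
    ∇ φ1 x = (1 / θ) • ∇ φθ x - ((1 - θ) / θ) • ∇ φn x := by
  have h1 : φ1 =ᶠ[𝓝 x] fun y => (1 / θ) * φθ y - ((1 - θ) / θ) * φn y := by
    filter_upwards [hD.mem_nhds hx] with y hy using hstep.potential_extrapolation y hy
  have h2 := ((hφθ.differentiableAt x hx).hasFDerivAt.const_mul (1 / θ)).sub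
    ((hφn.differentiableAt x hx).hasFDerivAt.const_mul ((1 - θ) / θ))
  rw [gradient, (h2.congr_of_eventuallyEq h1).fderiv]
  simp only [map_sub, map_smul, gradient]

/-- The pointwise form of the energy balance. -/
theorem IsThetaStep.energyDensity_balance
    (hstep : IsThetaStep D α τ θ Ω ρ vn vθ v1 φn φθ φ1) (hd : d = 2 ∨ d = 3) (hD : IsOpen D)
    (hα : 0 < α) (hτ : 0 < τ) (hθ : 0 < θ)
    (hφn : IsC1UpToBoundary D φn) (hφθ : IsC1UpToBoundary D φθ) {x : E d} (hx : x ∈ D) :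
    energyDensity α ρ v1 (∇ φ1) x
        + 2 * (θ - 1 / 2) * energyDensity α ρ (v1 - vn) (∇ φ1 - ∇ φn) x
      = energyDensity α ρ vn (∇ φn) x
        + 2 * α * τ * ⟪fluxField D α τ θ ρ vθ φn φθ x, ∇ φθ x⟫ := by
  -- Here `a` is the old value and `b` the intermediate one. The weight 2(θ - 1/2) makes the total
  -- coefficient of |b - a|² equal to 2/θ, which merges with the cross term (2/θ)⟨a, b - a⟩.
  have key : ∀ a b : E d, ‖(1 / θ) • b - ((1 - θ) / θ) • a‖ ^ 2
      + 2 * (θ - 1 / 2) * ‖(1 / θ) • b - ((1 - θ) / θ) • a - a‖ ^ 2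
      = ‖a‖ ^ 2 + 2 / θ * ⟪b - a, b⟫ := fun a b => by
    have e1 : (1 / θ) • b - ((1 - θ) / θ) • a - a = (1 / θ) • (b - a) := by
      have : (1 - θ) / θ = 1 / θ - 1 := by field_simp
      rw [this]
      module
    rw [e1, norm_sub_sq_real, norm_smul, norm_smul, norm_smul, mul_pow, mul_pow, mul_pow,
      norm_sub_sq_real, inner_sub_left, real_inner_smul_left, inner_smul_right,
      real_inner_self_eq_norm_sq, real_inner_comm b a]
    simp only [Real.norm_eq_abs, sq_abs]
    field_simp
    ring
  have hvel : ⟪vθ x - vn x, vθ x⟫ = -(θ * τ) * ⟪vθ x, ∇ φθ x⟫ := by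
    have : vθ x - vn x = (θ * τ) • magCross d (vθ x) (Ω x) - (θ * τ) • ∇ φθ x := by
      conv_lhs => rw [hstep.velocity x hx]
      module
    rw [this, inner_sub_left, real_inner_smul_left, real_inner_smul_left,
      inner_magCross_self hd, real_inner_comm (vθ x)]
    ring
  have k1 := key (vn x) (vθ x)
  have k2 := key (∇ φn x) (∇ φθ x)
  rw [hvel] at k1
  simp only [energyDensity, Pi.sub_apply, hstep.velocity_extrapolation x hx,
    hstep.gradient_extrapolation hD hφn hφθ hx, fluxField, hφn.closureGradient_eq hD hx,
    hφθ.closureGradient_eq hD hx]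
  rw [inner_sub_left, real_inner_smul_left, real_inner_smul_left, real_inner_smul_left]
  have e2 : 2 * α * τ * (1 / α * (1 / (θ * τ) * ⟪∇ φθ x - ∇ φn x, ∇ φθ x⟫)
      - ρ x * ⟪vθ x, ∇ φθ x⟫) = 2 / θ * ⟪∇ φθ x - ∇ φn x, ∇ φθ x⟫
      + α * ρ x * (2 / θ * (-(θ * τ) * ⟪vθ x, ∇ φθ x⟫)) := by
    field_simp
    ring
  rw [e2]
  linear_combination α * ρ x * k1 + k2

end Scheme

end EulerPoisson

end

/-! ### Integrating the pointwise balance and applying Green's formula. -/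

theorem mainTheorem6 (d : ℕ) (hd : d = 2 ∨ d = 3)
    (D : Set (EulerPoisson.E d)) (hDopen : IsOpen D) (hDbdd : Bornology.IsBounded D)
    (hDlip : EulerPoisson.HasLipschitzBoundary D)
    (α τ θ : ℝ) (hα : 0 < α) (hτ : 0 < τ) (hθ : 0 < θ)
    (Ω : EulerPoisson.E d → EulerPoisson.E (EulerPoisson.magDim d))
    (ρ : EulerPoisson.E d → ℝ) (hρ : ContinuousOn ρ (closure D))
    (vn vθ v1 : EulerPoisson.E d → EulerPoisson.E d) (φn φθ φ1 : EulerPoisson.E d → ℝ)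
    (hvn : MemLp vn 2 (volume.restrict D))
    (hvθ : ContinuousOn vθ (closure D))
    (hφn : EulerPoisson.IsC1UpToBoundary D φn)
    (hφθ : EulerPoisson.IsC1UpToBoundary D φθ)
    (hstep : EulerPoisson.IsThetaStep D α τ θ Ω ρ vn vθ v1 φn φθ φ1) :
    IntegrableOn (EulerPoisson.energyDensity α ρ v1 (∇ φ1)) D ∧
    IntegrableOn (EulerPoisson.energyDensity α ρ (v1 - vn) (∇ φ1 - ∇ φn)) D ∧
    IntegrableOn (EulerPoisson.energyDensity α ρ vn (∇ φn)) D ∧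
    Integrable (EulerPoisson.boundaryFlux D α τ θ ρ vθ φn φθ) (EulerPoisson.surfaceMeasure D) ∧
    EulerPoisson.energy D α ρ v1 (∇ φ1)
        + 2 * (θ - 1 / 2) * EulerPoisson.energy D α ρ (v1 - vn) (∇ φ1 - ∇ φn)
      = EulerPoisson.energy D α ρ vn (∇ φn)
        + τ * ∫ x, EulerPoisson.boundaryFlux D α τ θ ρ vθ φn φθ x
            ∂(EulerPoisson.surfaceMeasure D) := by
  have hmemθ := EulerPoisson.memLp_two_of_continuousOn_closure hDopen hDbdd hvθ
  have hgrad : ∀ {φ : EulerPoisson.E d → ℝ}, EulerPoisson.IsC1UpToBoundary D φ →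
      MemLp (∇ φ) 2 (volume.restrict D) := fun {φ} hφ => by
    refine (EulerPoisson.memLp_two_of_continuousOn_closure hDopen hDbdd
      hφ.continuousOn_closureGradient).ae_eq ?_
    filter_upwards [ae_restrict_mem hDopen.measurableSet] with x hx
      using hφ.closureGradient_eq hDopen hx
  have hmem1 : MemLp v1 2 (volume.restrict D) := by
    refine ((hmemθ.const_smul (1 / θ)).sub (hvn.const_smul ((1 - θ) / θ))).ae_eq ?_
    filter_upwards [ae_restrict_mem hDopen.measurableSet] with x hx
      using (hstep.velocity_extrapolation x hx).symm
  have hgrad1 : MemLp (∇ φ1) 2 (volume.restrict D) := by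
    refine (((hgrad hφθ).const_smul (1 / θ)).sub ((hgrad hφn).const_smul ((1 - θ) / θ))).ae_eq ?_
    filter_upwards [ae_restrict_mem hDopen.measurableSet] with x hx
      using (hstep.gradient_extrapolation hDopen hφn hφθ hx).symm
  have i1 := EulerPoisson.integrableOn_energyDensity (α := α) hDopen hDbdd hρ hmem1 hgrad1
  have i2 := EulerPoisson.integrableOn_energyDensity (α := α) hDopen hDbdd hρ (hmem1.sub hvn)
    (hgrad1.sub (hgrad hφn))
  have i3 := EulerPoisson.integrableOn_energyDensity (α := α) hDopen hDbdd hρ hvn (hgrad hφn)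
  have hflux := EulerPoisson.continuousOn_fluxField (α := α) (τ := τ) (θ := θ) hρ hvθ hφn hφθ
  obtain ⟨hbint, hgreen⟩ :=
    (hstep.weaklyDivFree_fluxField hDopen hDbdd hα hτ hθ hρ hvθ hφn hφθ).integral_inner_gradient
      hDopen hDbdd hDlip hflux hφθ
  -- By definition, `boundaryFlux` is the normal component of `fluxField` times `φθ`, so Green's
  -- formula applies verbatim.
  refine ⟨i1, i2, i3, hbint, ?_⟩
  have iflux : IntegrableOn
      (fun x => ⟪EulerPoisson.fluxField D α τ θ ρ vθ φn φθ x, ∇ φθ x⟫) D :=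
    (EulerPoisson.integrableOn_of_continuousOn_closure hDbdd
      (hflux.inner hφθ.continuousOn_closureGradient)).congr_fun
      (fun x hx => by simp only [hφθ.closureGradient_eq hDopen hx]) hDopen.measurableSet
  have hbal : (∫ x in D, EulerPoisson.energyDensity α ρ v1 (∇ φ1) x)
      + 2 * (θ - 1 / 2) * ∫ x in D, EulerPoisson.energyDensity α ρ (v1 - vn) (∇ φ1 - ∇ φn) x
      = (∫ x in D, EulerPoisson.energyDensity α ρ vn (∇ φn) x)
      + 2 * α * τ * ∫ x in D, ⟪EulerPoisson.fluxField D α τ θ ρ vθ φn φθ x, ∇ φθ x⟫ := by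
    rw [← integral_const_mul, ← integral_const_mul, ← integral_add i1 (i2.const_mul _),
      ← integral_add i3 (iflux.const_mul _)]
    exact setIntegral_congr_fun hDopen.measurableSet fun x hx =>
      hstep.energyDensity_balance hd hDopen hα hτ hθ hφn hφθ hx
  have hsurf : ∫ x, EulerPoisson.boundaryFlux D α τ θ ρ vθ φn φθ x ∂(EulerPoisson.surfaceMeasure D)
      = ∫ x in D, ⟪EulerPoisson.fluxField D α τ θ ρ vθ φn φθ x, ∇ φθ x⟫ := hgreen.symm
  rw [hsurf, EulerPoisson.energy, EulerPoisson.energy, EulerPoisson.energy]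
  have hα' : 1 / (2 * α) * (2 * α * τ) = τ := by field_simp
  linear_combination (1 / (2 * α)) * hbal + hα' *
    ∫ x in D, ⟪EulerPoisson.fluxField D α τ θ ρ vθ φn φθ x, ∇ φθ x⟫
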